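/- Let $m\ge 3$ and let $A=\{1,\dots,m\}$ be a set of alternatives. Each of $n$ agents has a strict linear order (ranking) over $A$; a profile $P=(R_1,\dots,R_n)$ lists the rankings. The plurality score of $a\in A$ in a profile is the number of agents that rank $a$ first, and the plurality winner $r(P)$ is the alternative of maximal plurality score, ties being broken in favour of the smallest index. Let $u=(u_1,\dots,u_m)$ be a real vector with $u_1\ge\dots\ge u_m\ge 0$ and $u_1>u_m$; the social welfare of $a$ is $\mathrm{SW}_u(P,a)=\sum_{j=1}^n u_{i_j(a)}$, where $i_j(a)$ is the position of $a$ in $R_j$. Starting with the truthful reports $P$, agents change their reported rankings one at a time. A change of agent $j$'s report is a best-response step if, according to $j$'s true ranking $R_j$, the new plurality winner (of the reported profile) is strictly preferred to the old one, and no other report of $j$ would give an outcome that $j$ prefers to the new one. A reported profile is a Nash equilibrium with respect to $P$ if no agent can change its report so as to obtain an outcome that it strictly prefers. Let $\mathrm{EW}(P)$ be the set of plurality winners of all Nash equilibria that can be reached from $P$ by a finite (possibly empty) sequence of best-response steps. The adversarial loss is $$D^+(P)=\mathrm{SW}_u(P,r(P))-\min_{a\in \mathrm{EW}(P)}\mathrm{SW}_u(P,a),$$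 and $\mathrm{EADPoA}(u,n)=\mathbb E[D^+(P)]$, where $P$ is drawn under Impartial Culture, i.e. the $n$ rankings are independent and uniformly distributed over all $m!$ strict linear orders. Theorem. Let $m\ge 3$ and let $u$ be as above with, in addition, $u_2>u_m$. Then $\mathrm{EW}(P)\neq\emptyset$ for every $n$ and every profile $P$ (so that $D^+(P)$ is well defined), and $\mathrm{EADPoA}(u,n)=-\Omega(1)$ as $n\to\infty$: there are a constant $c>0$ and an $N$, depending only on $m$ and $u$, such that $\mathrm{EADPoA}(u,n)\le -c$ for all $n\ge N$. -/

import Mathlib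

/-- A strict linear order over the alternatives `Fin m`, given by its position function:
`R a` is the position of the alternative `a` in `R`, and position `0` is the top. -/
abbrev Ranking (m : ℕ) : Type := Equiv.Perm (Fin m)

/-- A profile: one ranking per agent. -/
abbrev Profile (m n : ℕ) : Type := Fin n → Ranking m

/-- The top-ranked alternative of a ranking. -/
def topRank {m : ℕ} [NeZero m] (R : Ranking m) : Fin m := R.symm 0

/-- The plurality score of `a`: the number of agents whose ranking has `a` at the top. -/
def pluralityScore {m n : ℕ} [NeZero m] (P : Profile m n) (a : Fin m) : ℕ :=
  (Finset.univ.filter fun j => topRank (P j) = a).card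

/-- The alternatives of maximal plurality score. -/
def pluralityCowinners {m n : ℕ} [NeZero m] (P : Profile m n) : Finset (Fin m) :=
  Finset.univ.filter fun a => ∀ b, pluralityScore P b ≤ pluralityScore P a

theorem pluralityCowinners_nonempty {m n : ℕ} [NeZero m] (P : Profile m n) :
    (pluralityCowinners P).Nonempty := by
  obtain ⟨a, -, ha⟩ := Finset.exists_max_image Finset.univ (pluralityScore P) ⟨0, Finset.mem_univ 0⟩
  exact ⟨a, by simpa [pluralityCowinners] using ha⟩

/-- The resolute plurality rule: ties are broken in favour of the smallest index. -/
def pluralityWinner {m n : ℕ} [NeZero m] (P : Profile m n) : Fin m :=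
  (pluralityCowinners P).min' (pluralityCowinners_nonempty P)

/-- A rank-based utility vector: `u₁ ≥ ⋯ ≥ u_m ≥ 0` and `u₁ > u_m`. Indices start at `0` here, so
`u 0` is the utility of the top position and `u (Fin.rev 0)` that of the last one. -/
structure IsUtilityVector {m : ℕ} [NeZero m] (u : Fin m → ℝ) : Prop where
  antitone : Antitone u
  nonneg : ∀ i, 0 ≤ u i
  last_lt_first : u (Fin.rev 0) < u 0

/-- The additive social welfare of `a` with respect to the (truthful) profile `P`. -/
def socialWelfare {m n : ℕ} (u : Fin m → ℝ) (P : Profile m n) (a : Fin m) : ℝ :=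
  ∑ j, u (P j a)

/-- Agent `j`, whose true ranking is `P j`, strictly prefers the outcome of the reports that result
from the reported profile `Q` when `j` reports `R'` instead of `Q j`. -/
def IsBetterResponse {m n : ℕ} [NeZero m] (P Q : Profile m n) (j : Fin n) (R' : Ranking m) : Prop :=
  P j (pluralityWinner (Function.update Q j R')) < P j (pluralityWinner Q)

/-- A better response such that no other report of `j` achieves an outcome that `j` prefers. -/
def IsBestResponse {m n : ℕ} [NeZero m] (P Q : Profile m n) (j : Fin n) (R' : Ranking m) : Prop :=
  IsBetterResponse P Q j R' ∧
    ∀ R'' : Ranking m, P j (pluralityWinner (Function.update Q j R')) ≤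
      P j (pluralityWinner (Function.update Q j R''))

/-- One round of iterative plurality voting, with true preferences `P`: some agent makes a
best-response step that leads from the reported profile `Q` to `Q'`. -/
def BestResponseStep {m n : ℕ} [NeZero m] (P Q Q' : Profile m n) : Prop :=
  ∃ (j : Fin n) (R' : Ranking m), IsBestResponse P Q j R' ∧ Q' = Function.update Q j R'

/-- `Q` is a Nash equilibrium with respect to the true preferences `P`. -/
def IsNashEquilibrium {m n : ℕ} [NeZero m] (P Q : Profile m n) : Prop :=
  ∀ (j : Fin n) (R' : Ranking m), ¬ IsBetterResponse P Q j R'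

/-- The equilibrium winners: the winners of all Nash equilibria that some finite (possibly empty)
sequence of best-response steps reaches from the truthful profile `P`. -/
def equilibriumWinners {m n : ℕ} [NeZero m] (P : Profile m n) : Set (Fin m) :=
  {a | ∃ Q : Profile m n, Relation.ReflTransGen (BestResponseStep P) P Q ∧
    IsNashEquilibrium P Q ∧ pluralityWinner Q = a}

/-- The adversarial loss starting from `P`: the welfare of the truthful winner minus the smallest
welfare of an equilibrium winner. -/
noncomputable def adversarialLoss {m n : ℕ} [NeZero m] (u : Fin m → ℝ) (P : Profile m n) : ℝ :=
  socialWelfare u P (pluralityWinner P) - sInf (socialWelfare u P '' equilibriumWinners P)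

/-- The expected additive dynamic price of anarchy of plurality for a distribution over profiles. -/
noncomputable def expectedADPoA {m n : ℕ} [NeZero m] (u : Fin m → ℝ) (π : PMF (Profile m n)) : ℝ :=
  ∑ P, (π P).toReal * adversarialLoss u P

/-- Impartial Culture: the uniform distribution over profiles. -/
noncomputable def impartialCulture (m n : ℕ) : PMF (Profile m n) :=
  PMF.uniformOfFintype (Profile m n)

/-- Under Impartial Culture the rankings of the agents are independent and uniform. -/
theorem impartialCulture_apply (m n : ℕ) (P : Profile m n) :
    impartialCulture m n P = ∏ j, PMF.uniformOfFintype (Ranking m) (P j) := by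
  simp [impartialCulture, PMF.uniformOfFintype_apply, ENNReal.inv_pow]

/-! From the truthful profile, every best-response step is made by an agent who is not voting for
the current winner (`RefinedReports.topRank_ne_winner`). The winner keeps its votes and is
overtaken, so the winning score, with ties encoded, strictly rises. The dynamics therefore stops,
and equilibrium winners exist.

Pointwise there are three cases (`adversarialLoss_le`). If nobody is within one vote of the winner,
nothing moves and the loss is zero. If exactly two alternatives compete (`IsDuel`), only they ever
gain votes, and the equilibrium winner is their pairwise majority winner
(`IsDuel.equilibriumWinners_subset`). Otherwise three scores nearly agree (`IsNearTriple`). This has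
probability `O(1/n)`, and since welfare gaps have fourth moment `O(n^2)`, its contribution vanishes.

The negative constant comes from duels. Impartial Culture is invariant under exchanging `a` and `b`
in any set of rankings, so the set `Y` of agents preferring `a` may be averaged uniformly with
everything else fixed (`expect_orient`). The duel forces the agents ranking `a` or `b` first to
split at the median, and the remaining agents then decide whether the truthful winner is replaced.
Replacement happens when their majority opposes that winner, which biases the welfare gap towards
the new winner. The median split has probability of order `n^(-1/2)`, the bias per remaining agent
is again of order `n^(-1/2)`, and there are order `n` such agents whose expected utility gap is
positive because `u_2 > u_m`. The product is of order one (`expect_duelLoss_orient_le`,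
`expect_duelLoss_le`). Finally, the events `LeadsJointly` cover everything except near triples
(`one_le_sum_leadsJointly_add`), so summing over pairs leaves a fixed negative amount. All errors
are bounded by a multiple of `1 / r` with `r = n^(1/4)`. -/

open scoped BigOperators

/-! ### Best-response dynamics: termination, clear leads and duels -/

section Dynamics

variable {m n : ℕ} [NeZero m]

/-- Plurality score and index encoded in one number, whose strict maximum is at the winner. -/
def tieScore (Q : Profile m n) (a : Fin m) : ℕ := m * pluralityScore Q a + (Fin.rev a).val

theorem tieScore_injective (Q : Profile m n) : Function.Injective (tieScore Q) := by
  intro a b h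
  have h1 : tieScore Q a % m = tieScore Q b % m := by rw [h]
  simp only [tieScore, Nat.mul_add_mod] at h1
  rw [Nat.mod_eq_of_lt (Fin.rev a).isLt, Nat.mod_eq_of_lt (Fin.rev b).isLt] at h1
  exact Fin.rev_injective (Fin.ext h1)

theorem tieScore_lt_of_score_lt {Q : Profile m n} {a b : Fin m}
    (h : pluralityScore Q a < pluralityScore Q b) : tieScore Q a < tieScore Q b := by
  unfold tieScore
  have := (Fin.rev a).isLt
  have h2 : m * (pluralityScore Q a + 1) ≤ m * pluralityScore Q b := Nat.mul_le_mul_left m h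
  rw [Nat.mul_add] at h2
  omega

theorem score_le_of_tieScore_le {Q : Profile m n} {a b : Fin m}
    (h : tieScore Q a ≤ tieScore Q b) : pluralityScore Q a ≤ pluralityScore Q b := by
  by_contra! hlt
  exact absurd (tieScore_lt_of_score_lt hlt) (by omega)

theorem tieScore_lt_of_score_eq {Q : Profile m n} {a b : Fin m}
    (h : pluralityScore Q a = pluralityScore Q b) (hab : b < a) : tieScore Q a < tieScore Q b := by
  unfold tieScore
  rw [h]
  have := Fin.rev_lt_rev.2 hab
  have h3 : (Fin.rev a).val < (Fin.rev b).val := this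
  omega

theorem tieScore_le_winner (Q : Profile m n) (b : Fin m) :
    tieScore Q b ≤ tieScore Q (pluralityWinner Q) := by
  have hw : pluralityWinner Q ∈ pluralityCowinners Q := Finset.min'_mem _ _
  have hmax : ∀ c, pluralityScore Q c ≤ pluralityScore Q (pluralityWinner Q) := by
    simpa [pluralityCowinners] using hw
  rcases lt_or_eq_of_le (hmax b) with h | h
  · exact (tieScore_lt_of_score_lt h).le
  · have hb : b ∈ pluralityCowinners Q := by
      simp only [pluralityCowinners, Finset.mem_filter, Finset.mem_univ, true_and]
      intro c
      rw [h]
      exact hmax c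
    have hle : pluralityWinner Q ≤ b := Finset.min'_le _ _ hb
    rcases lt_or_eq_of_le hle with h' | h'
    · exact (tieScore_lt_of_score_eq h h').le
    · rw [h']

theorem pluralityWinner_eq {Q : Profile m n} {a : Fin m}
    (h : ∀ b, tieScore Q b ≤ tieScore Q a) : pluralityWinner Q = a :=
  tieScore_injective Q (le_antisymm (h _) (tieScore_le_winner Q a))

theorem tieScore_lt_winner {Q : Profile m n} {b : Fin m} (h : b ≠ pluralityWinner Q) :
    tieScore Q b < tieScore Q (pluralityWinner Q) :=
  lt_of_le_of_ne (tieScore_le_winner Q b) fun e => h (tieScore_injective Q e)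

theorem pluralityScore_update (Q : Profile m n) (j : Fin n) (R : Ranking m) (y : Fin m) :
    pluralityScore (Function.update Q j R) y + (if topRank (Q j) = y then 1 else 0) =
      pluralityScore Q y + (if topRank R = y then 1 else 0) := by
  simp only [pluralityScore, Finset.card_filter]
  rw [← Finset.add_sum_erase _ _ (Finset.mem_univ j),
    ← Finset.add_sum_erase (a := j) _ (fun i => if topRank (Q i) = y then 1 else 0)
      (Finset.mem_univ j)]
  have : ∑ i ∈ Finset.univ.erase j, (if topRank (Function.update Q j R i) = y then 1 else 0) =
      ∑ i ∈ Finset.univ.erase j, (if topRank (Q i) = y then 1 else 0) := by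
    refine Finset.sum_congr rfl fun i hi => ?_
    rw [Function.update_of_ne (Finset.ne_of_mem_erase hi)]
  rw [this, Function.update_self]
  omega

/-- One vote is worth `m`, more than any tie-breaking difference. The lost vote stands on the left
so that no truncated subtraction occurs. -/
theorem tieScore_update (Q : Profile m n) (j : Fin n) (R : Ranking m) (y : Fin m) :
    tieScore (Function.update Q j R) y + (if topRank (Q j) = y then m else 0) =
      tieScore Q y + (if topRank R = y then m else 0) := by
  have h := congrArg (m * ·) (pluralityScore_update Q j R y)
  simp only [mul_add, mul_ite, mul_one, mul_zero] at h
  simp only [tieScore]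
  omega

theorem topRank_swap (y : Fin m) : topRank (Equiv.swap 0 y : Ranking m) = y := by
  simp [topRank]

/-- Every report is weakly preferred by its agent to all alternatives that one more vote would
lift above some fixed losing alternative `w'`. -/
def RefinedReports (P Q : Profile m n) : Prop :=
  ∃ w', w' ≠ pluralityWinner Q ∧ ∀ y, tieScore Q w' < tieScore Q y + m →
    ∀ j, P j (topRank (Q j)) ≤ P j y

theorem apply_topRank (R : Ranking m) : R (topRank R) = 0 := by simp [topRank]

theorem refinedReports_truthful (hm : 2 ≤ m) (P : Profile m n) : RefinedReports P P := by
  have : Nontrivial (Fin m) := Fin.nontrivial_iff_two_le.2 hm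
  obtain ⟨w', hw'⟩ := exists_ne (pluralityWinner P)
  exact ⟨w', hw', fun y _ j => by rw [apply_topRank]; exact Fin.zero_le _⟩

/-- Suppose a voter for the winner could gain by making `y` win. Since `w'` loses no vote in the
change, `y` must overtake `w'` with at most one extra vote. Refinement then says that the present
vote, which is the winner, is already at least as good as `y`. -/
theorem RefinedReports.topRank_ne_winner {P Q : Profile m n} (h : RefinedReports P Q) {j : Fin n}
    {R : Ranking m} (hb : IsBetterResponse P Q j R) : topRank (Q j) ≠ pluralityWinner Q := by
  intro htop
  obtain ⟨w', hw', H⟩ := h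
  unfold IsBetterResponse at hb
  set y := pluralityWinner (Function.update Q j R) with hy
  have hyw : y ≠ pluralityWinner Q := fun e => by rw [e] at hb; exact lt_irrefl _ hb
  have hle := H y ?_ j
  · rw [htop] at hle
    exact absurd hb (not_lt.2 hle)
  · have h1 := tieScore_update Q j R w'
    have h2 := tieScore_update Q j R y
    have h3 := tieScore_le_winner (Function.update Q j R) w'
    rw [← hy] at h3
    rw [htop, if_neg (Ne.symm hw')] at h1
    rw [htop, if_neg (Ne.symm hyw)] at h2
    have hm : 0 < m := Nat.pos_of_ne_zero (NeZero.ne m)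
    by_cases e : y = w'
    · rw [e]; omega
    · have h4 : tieScore (Function.update Q j R) w' ≠ tieScore (Function.update Q j R) y :=
        fun e' => e (tieScore_injective _ e').symm
      split_ifs at h1 h2 <;> omega

/-- The old winner loses no vote here, so the only way to change the outcome is to lift a new
alternative over it by voting for it. -/
theorem better_response_of_loser {P Q : Profile m n} {j : Fin n} {R : Ranking m}
    (htop : topRank (Q j) ≠ pluralityWinner Q) (hb : IsBetterResponse P Q j R) :
    topRank R = pluralityWinner (Function.update Q j R) ∧
      topRank R ≠ pluralityWinner Q ∧ topRank (Q j) ≠ topRank R ∧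
      tieScore Q (pluralityWinner Q) < tieScore Q (topRank R) + m := by
  unfold IsBetterResponse at hb
  set y := pluralityWinner (Function.update Q j R) with hy
  have hyw : y ≠ pluralityWinner Q := fun e => by rw [e] at hb; exact lt_irrefl _ hb
  set w := pluralityWinner Q with hw
  have h1 := tieScore_update Q j R w
  have h2 := tieScore_update Q j R y
  have h3 := tieScore_le_winner (Function.update Q j R) w
  have h4 : tieScore Q y < tieScore Q w := tieScore_lt_winner hyw
  have h5 : tieScore (Function.update Q j R) w ≠ tieScore (Function.update Q j R) y :=
    fun e' => hyw (tieScore_injective _ e').symm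
  rw [← hy] at h3
  rw [if_neg htop] at h1
  have hR : topRank R = y := by
    by_contra hne
    rw [if_neg hne] at h2
    split_ifs at h1 h2 <;> omega
  have hne : topRank (Q j) ≠ y := by
    intro e
    rw [if_pos e, if_pos hR] at h2
    split_ifs at h1 <;> omega
  rw [if_neg hne, if_pos hR] at h2
  refine ⟨hR, by rw [hR]; exact hyw, by rw [hR]; exact hne, ?_⟩
  rw [hR]
  split_ifs at h1 <;> omega

/-- Supplies explicit deviations: they are compared with a best response in `RefinedReports.step`
and excluded at an equilibrium in `IsNashEquilibrium.topRank_eq`. -/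
theorem winner_update_swap {Q : Profile m n} {j : Fin n} {y : Fin m} (hy : topRank (Q j) ≠ y)
    (hlt : tieScore Q (pluralityWinner Q) < tieScore Q y + m) :
    pluralityWinner (Function.update Q j (Equiv.swap 0 y)) = y := by
  refine pluralityWinner_eq fun b => ?_
  have h1 := tieScore_update Q j (Equiv.swap 0 y) y
  have h2 := tieScore_update Q j (Equiv.swap 0 y) b
  have h3 := tieScore_le_winner Q b
  rw [topRank_swap] at h1 h2
  rw [if_neg hy, if_pos rfl] at h1
  by_cases e : y = b
  · rw [e]
  · rw [if_neg e] at h2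
    omega

/-- What a best-response step does when reports are refined. -/
theorem RefinedReports.step {P Q Q' : Profile m n} (h : RefinedReports P Q)
    (hs : BestResponseStep P Q Q') :
    RefinedReports P Q' ∧ tieScore Q (pluralityWinner Q) < tieScore Q' (pluralityWinner Q') ∧
    ∃ j R, Q' = Function.update Q j R ∧ topRank (Q j) ≠ pluralityWinner Q ∧
      topRank R = pluralityWinner Q' ∧ topRank R ≠ pluralityWinner Q ∧
      topRank (Q j) ≠ topRank R ∧ tieScore Q (pluralityWinner Q) < tieScore Q (topRank R) + m ∧
      P j (topRank R) < P j (pluralityWinner Q) := by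
  obtain ⟨j, R, ⟨hb, hbest⟩, rfl⟩ := hs
  have htop := h.topRank_ne_winner hb
  obtain ⟨h1, h2, h3, h4⟩ := better_response_of_loser htop hb
  have hF := tieScore_update Q j R
  have hw := hF (pluralityWinner Q)
  rw [if_neg htop, if_neg h2] at hw
  have hy := hF (topRank R)
  rw [if_neg h3, if_pos rfl] at hy
  -- The old winner becomes the new fixed loser. Whatever is one vote from beating it now was so
  -- before the step; among these the mover chose its favourite, and the other agents inherit the
  -- old condition.
  refine ⟨⟨pluralityWinner Q, by rw [← h1]; exact h2.symm, ?_⟩, by rw [← h1]; omega,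
    j, R, rfl, htop, h1, h2, h3, h4, ?_⟩
  · intro y hlt k
    have hyF := hF y
    have hold : tieScore Q (pluralityWinner Q) < tieScore Q y + m := by
      by_cases e : topRank R = y
      · rw [← e]; exact h4
      · rw [if_neg e] at hyF
        omega
    by_cases hk : k = j
    · subst hk
      rw [Function.update_self]
      by_cases e : topRank R = y
      · rw [e]
      by_cases e2 : topRank (Q k) = y
      · rw [if_neg e, if_pos e2] at hyF
        have := tieScore_le_winner Q y
        omega
      · have h5 := hbest (Equiv.swap 0 y)
        rwa [winner_update_swap e2 hold, ← h1] at h5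
    · rw [Function.update_of_ne hk]
      obtain ⟨w', -, H⟩ := h
      exact H y (lt_of_le_of_lt (tieScore_le_winner Q w') hold) k
  · rw [h1]; exact hb

theorem exists_bestResponseStep {P Q : Profile m n} (h : ¬ IsNashEquilibrium P Q) :
    ∃ Q', BestResponseStep P Q Q' := by
  simp only [IsNashEquilibrium, not_forall, not_not] at h
  obtain ⟨j, R, hR⟩ := h
  obtain ⟨R', -, hmin⟩ := Finset.exists_min_image Finset.univ
    (fun R'' : Ranking m => P j (pluralityWinner (Function.update Q j R''))) ⟨R, Finset.mem_univ R⟩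
  exact ⟨_, j, R', ⟨lt_of_le_of_lt (hmin R (Finset.mem_univ R)) hR,
    fun R'' => hmin R'' (Finset.mem_univ R'')⟩, rfl⟩

theorem tieScore_lt_bound (Q : Profile m n) (a : Fin m) : tieScore Q a < m * (n + 1) := by
  have h1 : pluralityScore Q a ≤ n := by
    simpa [pluralityScore] using Finset.card_filter_le (Finset.univ : Finset (Fin n))
      (fun j => topRank (Q j) = a)
  have h2 := (Fin.rev a).isLt
  have h3 := Nat.mul_le_mul_left m h1
  rw [tieScore, Nat.mul_add]
  omega

/-- The winner's `tieScore` strictly increases along the dynamics and is bounded by `m * (n + 1)`,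
so the remaining gap is an induction measure. -/
theorem equilibriumWinners_nonempty (hm : 2 ≤ m) (P : Profile m n) :
    (equilibriumWinners P).Nonempty := by
  suffices H : ∀ k, ∀ Q : Profile m n, m * (n + 1) - tieScore Q (pluralityWinner Q) = k →
      RefinedReports P Q → ∃ Q', Relation.ReflTransGen (BestResponseStep P) Q Q' ∧
        IsNashEquilibrium P Q' by
    obtain ⟨Q', h1, h2⟩ := H _ P rfl (refinedReports_truthful hm P)
    exact ⟨_, Q', h1, h2, rfl⟩
  intro k
  induction k using Nat.strong_induction_on with
  | _ k ih =>
    intro Q hk hQ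
    by_cases hN : IsNashEquilibrium P Q
    · exact ⟨Q, .refl, hN⟩
    · obtain ⟨Q₁, hs⟩ := exists_bestResponseStep hN
      obtain ⟨h1, h2, -⟩ := hQ.step hs
      have h3 := tieScore_lt_bound Q₁ (pluralityWinner Q₁)
      obtain ⟨Q', h4, h5⟩ := ih _ (by omega) Q₁ rfl h1
      exact ⟨Q', h4.head hs, h5⟩

theorem RefinedReports.reachable {P Q : Profile m n} (hm : 2 ≤ m)
    (h : Relation.ReflTransGen (BestResponseStep P) P Q) : RefinedReports P Q := by
  induction h with
  | refl => exact refinedReports_truthful hm P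
  | tail _ hs ih => exact (ih.step hs).1

theorem equilibriumWinners_subset_of_clear_lead (hm : 2 ≤ m) {P : Profile m n}
    (h : ∀ y, y ≠ pluralityWinner P → tieScore P y + m ≤ tieScore P (pluralityWinner P)) :
    equilibriumWinners P ⊆ {pluralityWinner P} := by
  rintro a ⟨Q, hreach, -, rfl⟩
  rcases hreach.cases_head with rfl | ⟨Q₁, hs, -⟩
  · rfl
  · obtain ⟨-, -, j, R, -, -, -, h2, -, h4, -⟩ := (refinedReports_truthful hm P).step hs
    have := h _ h2
    omega

/-! ### Duels -/

/-- The number of agents who prefer `a` to `b`. -/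
def supporters (P : Profile m n) (a b : Fin m) : ℕ :=
  (Finset.univ.filter fun j => P j a < P j b).card

/-- `a` and `b` are ahead of all others, `a` wins a tie, and one vote decides between them. -/
structure IsDuel (Q : Profile m n) (a b : Fin m) : Prop where
  lt : a < b
  close : pluralityScore Q b = pluralityScore Q a ∨ pluralityScore Q b = pluralityScore Q a + 1
  others : ∀ c, c ≠ a → c ≠ b → pluralityScore Q c + 2 ≤ pluralityScore Q b

theorem IsDuel.winner_of_eq {Q : Profile m n} {a b : Fin m} (h : IsDuel Q a b)
    (he : pluralityScore Q b = pluralityScore Q a) : pluralityWinner Q = a := by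
  refine pluralityWinner_eq fun c => ?_
  by_cases hca : c = a
  · rw [hca]
  by_cases hcb : c = b
  · rw [hcb]; exact (tieScore_lt_of_score_eq he h.lt).le
  · have := h.others c hca hcb
    exact (tieScore_lt_of_score_lt (by omega)).le

theorem IsDuel.winner_of_eq_succ {Q : Profile m n} {a b : Fin m} (h : IsDuel Q a b)
    (he : pluralityScore Q b = pluralityScore Q a + 1) : pluralityWinner Q = b := by
  refine pluralityWinner_eq fun c => ?_
  by_cases hcb : c = b
  · rw [hcb]
  by_cases hca : c = a
  · rw [hca]; exact (tieScore_lt_of_score_lt (by omega)).le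
  · have := h.others c hca hcb
    exact (tieScore_lt_of_score_lt (by omega)).le

theorem IsDuel.eq_or_eq_of_threat {Q : Profile m n} {a b y : Fin m} (h : IsDuel Q a b)
    (hy : tieScore Q (pluralityWinner Q) < tieScore Q y + m) : y = a ∨ y = b := by
  by_contra! hne
  have h1 := h.others y hne.1 hne.2
  have h2 := tieScore_le_winner Q b
  have h3 := Nat.mul_le_mul_left m h1
  have h4 := (Fin.rev y).isLt
  rw [Nat.mul_add] at h3
  unfold tieScore at *
  omega

/-- In a duel the reports are truthful, or for the preferred duellist. -/
def DuelReports (P Q : Profile m n) (a b : Fin m) : Prop :=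
  ∀ j, topRank (Q j) = topRank (P j) ∨ (topRank (Q j) = a ∧ P j a < P j b) ∨
    (topRank (Q j) = b ∧ P j b < P j a)

/-- The mover votes neither for the winner nor for its target, and these are the two duellists.
Hence its vote comes from a third alternative, the trailing duellist gains it, and no third
alternative comes closer. -/
theorem IsDuel.step {P Q Q' : Profile m n} {a b : Fin m} (h : IsDuel Q a b)
    (hd : DuelReports P Q a b) (hr : RefinedReports P Q) (hs : BestResponseStep P Q Q') :
    IsDuel Q' a b ∧ DuelReports P Q' a b := by
  obtain ⟨-, -, j, R, rfl, h1, h2, h3, h4, h5, h6⟩ := hr.step hs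
  have hab : a ≠ b := h.lt.ne
  have hs := pluralityScore_update Q j R
  have hy := h.eq_or_eq_of_threat h5
  have hclose := h.close
  have hsa := hs a
  have hsb := hs b
  rcases h.close with he | he
  · have hw := h.winner_of_eq he
    rw [hw] at h1 h3 h6
    have hyb : topRank R = b := by tauto
    rw [hyb] at h4 h6
    rw [hyb, if_neg h1, if_neg hab.symm] at hsa
    rw [hyb, if_neg h4, if_pos rfl] at hsb
    refine ⟨⟨h.lt, by omega, fun c hca hcb => ?_⟩, fun k => ?_⟩
    · have hsc := hs c
      rw [hyb, if_neg (Ne.symm hcb)] at hsc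
      have := h.others c hca hcb
      omega
    · by_cases hk : k = j
      · subst hk
        rw [Function.update_self]
        exact Or.inr (Or.inr ⟨hyb, h6⟩)
      · rw [Function.update_of_ne hk]; exact hd k
  · have hw := h.winner_of_eq_succ he
    rw [hw] at h1 h3 h6
    have hya : topRank R = a := by tauto
    rw [hya] at h4 h6
    rw [hya, if_neg h4, if_pos rfl] at hsa
    rw [hya, if_neg h1, if_neg hab] at hsb
    refine ⟨⟨h.lt, by omega, fun c hca hcb => ?_⟩, fun k => ?_⟩
    · have hsc := hs c
      rw [hya, if_neg (Ne.symm hca)] at hsc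
      have := h.others c hca hcb
      omega
    · by_cases hk : k = j
      · subst hk
        rw [Function.update_self]
        exact Or.inr (Or.inl ⟨hya, h6⟩)
      · rw [Function.update_of_ne hk]; exact hd k

theorem IsDuel.reachable (hm : 2 ≤ m) {P Q : Profile m n} {a b : Fin m} (h : IsDuel P a b)
    (hreach : Relation.ReflTransGen (BestResponseStep P) P Q) :
    IsDuel Q a b ∧ DuelReports P Q a b := by
  induction hreach with
  | refl => exact ⟨h, fun j => Or.inl rfl⟩
  | tail hr hs ih => exact ih.1.step ih.2 (RefinedReports.reachable hm hr) hs

theorem apply_lt_of_topRank_eq {R : Ranking m} {a b : Fin m} (h : topRank R = a) (hab : a ≠ b) :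
    R a < R b := by
  rw [← h, apply_topRank]
  refine Fin.pos_iff_ne_zero.2 fun e => hab ?_
  rw [← h, topRank, ← e, Equiv.symm_apply_apply]

theorem DuelReports.supports {P Q : Profile m n} {a b : Fin m} (h : DuelReports P Q a b)
    (hab : a ≠ b) (j : Fin n) :
    (topRank (Q j) = a → P j a < P j b) ∧ (topRank (Q j) = b → P j b < P j a) := by
  rcases h j with h | ⟨h, h'⟩ | ⟨h, h'⟩
  · rw [h]
    exact ⟨fun e => apply_lt_of_topRank_eq e hab, fun e => apply_lt_of_topRank_eq e hab.symm⟩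
  · exact ⟨fun _ => h', fun e => absurd (h.symm.trans e) hab⟩
  · exact ⟨fun e => absurd (e.symm.trans h) hab, fun _ => h'⟩

theorem IsNashEquilibrium.topRank_eq {P Q : Profile m n} (h : IsNashEquilibrium P Q) {j : Fin n}
    {y : Fin m} (hlt : tieScore Q (pluralityWinner Q) < tieScore Q y + m)
    (hp : P j y < P j (pluralityWinner Q)) : topRank (Q j) = y := by
  by_contra hne
  refine h j (Equiv.swap 0 y) ?_
  rw [IsBetterResponse, winner_update_swap hne hlt]
  exact hp

/-- The equilibrium winner of a duel is the winner of the pairwise majority vote. -/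
theorem IsDuel.equilibriumWinners_subset (hm : 2 ≤ m) {P : Profile m n} {a b : Fin m}
    (h : IsDuel P a b) :
    equilibriumWinners P ⊆ {if supporters P a b < supporters P b a then b else a} := by
  rintro x ⟨Q, hreach, hN, rfl⟩
  obtain ⟨hQ, hd⟩ := h.reachable hm hreach
  have hab : a ≠ b := h.lt.ne
  -- Votes for a duellist come only from agents who truly prefer it to the other one.
  have hsa : pluralityScore Q a ≤ supporters P a b := by
    refine Finset.card_le_card fun j => ?_
    simp only [Finset.mem_filter, Finset.mem_univ, true_and]
    exact (hd.supports hab j).1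
  have hsb : pluralityScore Q b ≤ supporters P b a := by
    refine Finset.card_le_card fun j => ?_
    simp only [Finset.mem_filter, Finset.mem_univ, true_and]
    exact (hd.supports hab j).2
  rcases hQ.close with he | he
  · have hw := hQ.winner_of_eq he
    -- At an equilibrium every supporter of the losing duellist already votes for it, since one more
    -- vote would make it win. The scores thus reveal the pairwise majority.
    have : supporters P b a ≤ pluralityScore Q b := by
      refine Finset.card_le_card fun j => ?_
      simp only [Finset.mem_filter, Finset.mem_univ, true_and]
      intro hj
      refine hN.topRank_eq ?_ (by rwa [hw])
      rw [hw]
      have := (Fin.rev a).isLt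
      unfold tieScore
      rw [he]; omega
    rw [hw, if_neg (by omega)]; rfl
  · have hw := hQ.winner_of_eq_succ he
    have : supporters P a b ≤ pluralityScore Q a := by
      refine Finset.card_le_card fun j => ?_
      simp only [Finset.mem_filter, Finset.mem_univ, true_and]
      intro hj
      refine hN.topRank_eq ?_ (by rwa [hw])
      rw [hw]
      have h2 : (Fin.rev b).val < (Fin.rev a).val := Fin.rev_lt_rev.2 h.lt
      unfold tieScore
      rw [he, Nat.mul_add]; omega
    rw [hw, if_pos (by omega)]; rfl

end Dynamics

/-! ### Pointwise bound on the loss: clear lead, duel or near triple -/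

section PointwiseLoss

variable {m n : ℕ} [NeZero m]

/-- The adversarial loss in a duel between `a` and `b`. -/
noncomputable def duelLoss (u : Fin m → ℝ) (P : Profile m n) (a b : Fin m) : ℝ :=
  if pluralityScore P b = pluralityScore P a then
    (if supporters P a b < supporters P b a then socialWelfare u P a - socialWelfare u P b else 0)
  else
    (if supporters P a b < supporters P b a then 0 else socialWelfare u P b - socialWelfare u P a)

/-- Three alternatives with almost the same plurality score. -/
structure IsNearTriple (P : Profile m n) (a b c : Fin m) : Prop where
  ne_ab : a ≠ b
  ne_bc : b ≠ c
  ne_ac : a ≠ c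
  ab : pluralityScore P a ≤ pluralityScore P b + 2
  ba : pluralityScore P b ≤ pluralityScore P a + 2
  bc : pluralityScore P b ≤ pluralityScore P c + 2
  cb : pluralityScore P c ≤ pluralityScore P b + 2

theorem adversarialLoss_of_subset_singleton {u : Fin m → ℝ} {P : Profile m n} {x : Fin m}
    (hm : 2 ≤ m) (h : equilibriumWinners P ⊆ {x}) :
    adversarialLoss u P = socialWelfare u P (pluralityWinner P) - socialWelfare u P x := by
  have hx : equilibriumWinners P = {x} :=
    (Set.subset_singleton_iff_eq.1 h).resolve_left (equilibriumWinners_nonempty hm P).ne_empty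
  rw [adversarialLoss, hx, Set.image_singleton, csInf_singleton]

/-- A crude bound, used only on near triples, where nothing is known about the equilibrium winners.
-/
theorem adversarialLoss_le_sum (hm : 2 ≤ m) (u : Fin m → ℝ) (P : Profile m n) :
    adversarialLoss u P ≤ ∑ a, ∑ b, |socialWelfare u P a - socialWelfare u P b| := by
  have hne := (equilibriumWinners_nonempty hm P).image (socialWelfare u P)
  have hfin : (socialWelfare u P '' equilibriumWinners P).Finite := Set.toFinite _
  obtain ⟨x, -, hx⟩ := hne.csInf_mem hfin
  rw [adversarialLoss, ← hx]
  refine (le_abs_self _).trans ?_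
  refine (Finset.single_le_sum
    (f := fun b => |socialWelfare u P (pluralityWinner P) - socialWelfare u P b|)
    (fun _ _ => abs_nonneg _) (Finset.mem_univ x)).trans ?_
  exact Finset.single_le_sum
    (f := fun a => ∑ b, |socialWelfare u P a - socialWelfare u P b|)
    (fun _ _ => Finset.sum_nonneg fun _ _ => abs_nonneg _) (Finset.mem_univ _)

theorem IsDuel.adversarialLoss_eq (hm : 2 ≤ m) (u : Fin m → ℝ) {P : Profile m n} {a b : Fin m}
    (h : IsDuel P a b) : adversarialLoss u P = duelLoss u P a b := by
  rw [adversarialLoss_of_subset_singleton hm (h.equilibriumWinners_subset hm), duelLoss]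
  rcases h.close with he | he
  · rw [h.winner_of_eq he, if_pos he]
    split_ifs <;> simp
  · have hne : ¬ pluralityScore P b = pluralityScore P a := by omega
    rw [h.winner_of_eq_succ he, if_neg hne]
    split_ifs <;> simp

theorem IsDuel.unique {P : Profile m n} {a b a' b' : Fin m} (h : IsDuel P a b)
    (h' : IsDuel P a' b') : a' = a ∧ b' = b := by
  have h1 := h.close
  have h2 := h'.close
  have h3 := h.lt
  have h4 := h'.lt
  have key : ∀ {a b a' b' : Fin m}, IsDuel P a b → IsDuel P a' b' → a' = a ∨ a' = b := by
    intro a b a' b' h h'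
    by_contra! hne
    have e1 := h.others a' hne.1 hne.2
    have e2 := h'.close
    have e3 := h.close
    by_cases hb : b = b'
    · subst hb; omega
    · by_cases hb2 : b = a'
      · exact hne.2 hb2.symm
      · have := h'.others b hb2 hb
        omega
  have key2 : b' = a ∨ b' = b := by
    by_contra! hne
    have e1 := h.others b' hne.1 hne.2
    by_cases hb : b = a'
    · subst hb; omega
    · have := h'.others b hb (Ne.symm hne.2)
      omega
  have k1 := key h h'
  rcases k1 with rfl | rfl
  · refine ⟨rfl, key2.resolve_left fun e => ?_⟩
    subst e; exact lt_irrefl _ h4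
  · rcases key2 with rfl | rfl
    · exact absurd (h3.trans h4) (lt_irrefl _)
    · exact absurd h4 (lt_irrefl _)

theorem clear_lead_of_not_duel {P : Profile m n} (h1 : ∀ a b, ¬ IsDuel P a b)
    (h2 : ∀ a b c, ¬ IsNearTriple P a b c) (y : Fin m) (hy : y ≠ pluralityWinner P) :
    tieScore P y + m ≤ tieScore P (pluralityWinner P) := by
  by_contra! hlt
  set w := pluralityWinner P with hw
  have hyw := tieScore_lt_winner hy
  rw [← hw] at hyw
  have hle := score_le_of_tieScore_le hyw.le
  have hr1 := (Fin.rev w).isLt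
  have hr2 := (Fin.rev y).isLt
  have hs : pluralityScore P w ≤ pluralityScore P y + 1 := by
    by_contra! hs
    have := Nat.mul_le_mul_left m hs
    unfold tieScore at hlt
    rw [Nat.mul_succ, Nat.mul_succ] at this
    omega
  have hoth : ∀ c, c ≠ y → c ≠ w → pluralityScore P c + 2 ≤ pluralityScore P w := by
    intro c hcy hcw
    by_contra! hc
    have := score_le_of_tieScore_le (tieScore_le_winner P c)
    rw [← hw] at this
    exact h2 w y c ⟨hy.symm, hcy.symm, hcw.symm, by omega, by omega, by omega, by omega⟩
  rcases lt_or_gt_of_ne hy with hlt' | hlt'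
  · have hne : pluralityScore P y ≠ pluralityScore P w := fun e =>
      absurd (tieScore_lt_of_score_eq e.symm hlt') (by omega)
    exact h1 y w ⟨hlt', by omega, hoth⟩
  · have hne : pluralityScore P y = pluralityScore P w := by
      by_contra hne
      have e : pluralityScore P w = pluralityScore P y + 1 := by omega
      have h3 : (Fin.rev y).val < (Fin.rev w).val := Fin.rev_lt_rev.2 hlt'
      unfold tieScore at hlt
      rw [e, Nat.mul_succ] at hlt
      omega
    exact h1 w y ⟨hlt', Or.inl hne, fun c h h' => by rw [hne]; exact hoth c h' h⟩

-- At most one pair is in a duel, so the first sum has at most one nonzero term. The second term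
-- need only be nonnegative unless there is no duel and some near triple exists.
open scoped Classical in
theorem adversarialLoss_le (hm : 2 ≤ m) (u : Fin m → ℝ) (P : Profile m n) :
    adversarialLoss u P ≤ (∑ a, ∑ b, if IsDuel P a b then duelLoss u P a b else 0) +
      (∑ a, ∑ b, ∑ c, if IsNearTriple P a b c then (1 : ℝ) else 0) *
        ∑ a, ∑ b, |socialWelfare u P a - socialWelfare u P b| := by
  have hD : 0 ≤ ∑ a, ∑ b, |socialWelfare u P a - socialWelfare u P b| :=
    Finset.sum_nonneg fun _ _ => Finset.sum_nonneg fun _ _ => abs_nonneg _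
  have h01 : ∀ a b c, 0 ≤ (if IsNearTriple P a b c then (1 : ℝ) else 0) := fun a b c => by
    split_ifs <;> norm_num
  by_cases h : ∃ a b, IsDuel P a b
  · obtain ⟨a, b, h⟩ := h
    have : (∑ a, ∑ b, if IsDuel P a b then duelLoss u P a b else 0) = duelLoss u P a b := by
      rw [Finset.sum_eq_single a, Finset.sum_eq_single b, if_pos h]
      · intro b' _ hb'
        rw [if_neg fun h' => hb' (h.unique h').2]
      · simp
      · intro a' _ ha'
        exact Finset.sum_eq_zero fun b' _ => if_neg fun h' => ha' (h.unique h').1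
      · simp
    rw [this, h.adversarialLoss_eq hm u]
    exact le_add_of_nonneg_right (mul_nonneg (Finset.sum_nonneg fun _ _ =>
      Finset.sum_nonneg fun _ _ => Finset.sum_nonneg fun _ _ => h01 _ _ _) hD)
  · push Not at h
    rw [Finset.sum_eq_zero fun a _ => Finset.sum_eq_zero fun b _ => if_neg (h a b), zero_add]
    by_cases h2 : ∃ a b c, IsNearTriple P a b c
    · obtain ⟨a, b, c, h2⟩ := h2
      have h3 : 1 ≤ ∑ a, ∑ b, ∑ c, if IsNearTriple P a b c then (1 : ℝ) else 0 := by
        calc (1 : ℝ) = if IsNearTriple P a b c then (1 : ℝ) else 0 := (if_pos h2).symm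
          _ ≤ ∑ c, if IsNearTriple P a b c then (1 : ℝ) else 0 :=
            Finset.single_le_sum (f := fun c => if IsNearTriple P a b c then (1 : ℝ) else 0)
              (fun _ _ => h01 _ _ _) (Finset.mem_univ c)
          _ ≤ ∑ b, ∑ c, if IsNearTriple P a b c then (1 : ℝ) else 0 :=
            Finset.single_le_sum
              (f := fun b => ∑ c, if IsNearTriple P a b c then (1 : ℝ) else 0)
              (fun _ _ => Finset.sum_nonneg fun _ _ => h01 _ _ _) (Finset.mem_univ b)
          _ ≤ _ := Finset.single_le_sum
              (f := fun a => ∑ b, ∑ c, if IsNearTriple P a b c then (1 : ℝ) else 0)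
              (fun _ _ => Finset.sum_nonneg fun _ _ => Finset.sum_nonneg fun _ _ => h01 _ _ _)
              (Finset.mem_univ a)
      exact (adversarialLoss_le_sum hm u P).trans (le_mul_of_one_le_left hD h3)
    · push Not at h2
      rw [adversarialLoss_of_subset_singleton hm
        (equilibriumWinners_subset_of_clear_lead hm (clear_lead_of_not_duel h h2)), sub_self]
      exact mul_nonneg (Finset.sum_nonneg fun _ _ =>
        Finset.sum_nonneg fun _ _ => Finset.sum_nonneg fun _ _ => h01 _ _ _) hD

/-- `a` and `b` stay ahead of the others when their joint score is shared out equally. -/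
structure LeadsJointly (P : Profile m n) (a b : Fin m) : Prop where
  lt : a < b
  others : ∀ c, c ≠ a → c ≠ b →
    pluralityScore P c + 2 ≤ (pluralityScore P a + pluralityScore P b + 1) / 2

/-- Separates a condition that is invariant under exchanging `a` and `b` in rankings from the
requirement that `a` receive the lower median of the joint score. -/
theorem isDuel_iff {P : Profile m n} {a b : Fin m} :
    IsDuel P a b ↔ LeadsJointly P a b ∧
      pluralityScore P a = (pluralityScore P a + pluralityScore P b) / 2 := by
  constructor
  · intro h
    have := h.close
    refine ⟨⟨h.lt, fun c hca hcb => ?_⟩, by omega⟩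
    have := h.others c hca hcb
    omega
  · rintro ⟨h, h'⟩
    refine ⟨h.lt, by omega, fun c hca hcb => ?_⟩
    have := h.others c hca hcb
    omega

/-- Take the two highest scores. A third score too close to their average is within two of both of
them. -/
theorem exists_leadsJointly (hm : 2 ≤ m) {P : Profile m n}
    (h : ∀ a b c, ¬ IsNearTriple P a b c) : ∃ a b, LeadsJointly P a b := by
  have : Nontrivial (Fin m) := Fin.nontrivial_iff_two_le.2 hm
  obtain ⟨a, -, ha⟩ := Finset.exists_max_image Finset.univ (pluralityScore P) ⟨0, Finset.mem_univ 0⟩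
  obtain ⟨b₀, hb₀⟩ := exists_ne a
  obtain ⟨b, hb, hbmax⟩ := Finset.exists_max_image (Finset.univ.erase a) (pluralityScore P)
    ⟨b₀, by simp [hb₀]⟩
  have hba : b ≠ a := Finset.ne_of_mem_erase hb
  have key : ∀ c, c ≠ a → c ≠ b →
      pluralityScore P c + 2 ≤ (pluralityScore P a + pluralityScore P b + 1) / 2 := by
    intro c hca hcb
    by_contra! hlt
    have h1 := ha b (Finset.mem_univ b)
    have h2 := hbmax c (by simp [hca])
    exact h a b c ⟨hba.symm, hcb.symm, hca.symm, by omega, by omega, by omega, by omega⟩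
  rcases lt_or_gt_of_ne hba with hlt | hlt
  · exact ⟨b, a, hlt, fun c hb ha => by rw [add_comm (pluralityScore P b)]; exact key c ha hb⟩
  · exact ⟨a, b, hlt, key⟩

end PointwiseLoss

/-! ### Central binomial estimates and sums of random signs -/

section SignSums

theorem Finset.sum_powerset_inter_sdiff {ι M : Type*} [DecidableEq ι] [AddCommMonoid M]
    {S G : Finset ι} (hG : G ⊆ S) (F : Finset ι → Finset ι → M) :
    ∑ Y ∈ S.powerset, F (Y ∩ G) (Y \ G) = ∑ A ∈ G.powerset, ∑ B ∈ (S \ G).powerset, F A B := by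
  rw [← Finset.sum_product']
  refine Finset.sum_nbij' (fun Y => (Y ∩ G, Y \ G)) (fun p => p.1 ∪ p.2) ?_ ?_ ?_ ?_ ?_
  · intro Y hY
    simp only [Finset.mem_product, Finset.mem_powerset] at hY ⊢
    exact ⟨Finset.inter_subset_right, Finset.sdiff_subset_sdiff hY le_rfl⟩
  · rintro ⟨A, B⟩ h
    simp only [Finset.mem_product, Finset.mem_powerset] at h ⊢
    exact Finset.union_subset (h.1.trans hG) (h.2.trans Finset.sdiff_subset)
  · intro Y _
    ext x; simp only [Finset.mem_union, Finset.mem_inter, Finset.mem_sdiff]; tauto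
  · rintro ⟨A, B⟩ h
    simp only [Finset.mem_product, Finset.mem_powerset] at h
    have h1 : ∀ x ∈ A, x ∈ G := fun x hx => h.1 hx
    have h2 : ∀ x ∈ B, x ∉ G := fun x hx => (Finset.mem_sdiff.1 (h.2 hx)).2
    refine Prod.ext ?_ ?_
    · ext x; simp only [Finset.mem_union, Finset.mem_inter]
      have := h1 x; have := h2 x; tauto
    · ext x; simp only [Finset.mem_union, Finset.mem_sdiff]
      have := h1 x; have := h2 x; tauto
  · intro Y _; rfl

/-- The probability that a fair binomial variable takes its median value. -/
noncomputable def medianProb (k : ℕ) : ℝ := (k.choose (k / 2) : ℝ) / 2 ^ k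

theorem medianProb_nonneg (k : ℕ) : 0 ≤ medianProb k := by unfold medianProb; positivity

theorem choose_le_two_pow_mul_medianProb (k i : ℕ) : (k.choose i : ℝ) ≤ 2 ^ k * medianProb k := by
  rw [medianProb, mul_div_cancel₀ _ (by positivity)]
  exact_mod_cast Nat.choose_le_middle i k

theorem medianProb_two_mul_succ (j : ℕ) :
    medianProb (2 * (j + 1)) * (2 * (j + 1)) = medianProb (2 * j) * (2 * j + 1) := by
  have h := Nat.succ_mul_centralBinom_succ j
  rw [Nat.centralBinom_eq_two_mul_choose, Nat.centralBinom_eq_two_mul_choose] at h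
  have h' : ((j : ℝ) + 1) * ((2 * (j + 1)).choose (j + 1) : ℝ) =
      2 * (2 * j + 1) * ((2 * j).choose j : ℝ) := by exact_mod_cast h
  have e1 : 2 * (j + 1) / 2 = j + 1 := by omega
  have e2 : 2 * j / 2 = j := by omega
  rw [medianProb, medianProb, e1, e2, pow_mul, pow_mul, pow_succ]
  have h4 : ((2 : ℝ) ^ 2) ^ j ≠ 0 := by positivity
  field_simp
  linear_combination h'

theorem medianProb_odd (j : ℕ) : medianProb (2 * j + 1) = medianProb (2 * (j + 1)) := by
  have e1 : (2 * j + 1) / 2 = j := by omega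
  have e2 : 2 * (j + 1) / 2 = j + 1 := by omega
  have h : (2 * (j + 1)).choose (j + 1) = 2 * (2 * j + 1).choose j := by
    rw [show 2 * (j + 1) = (2 * j + 1) + 1 by ring, Nat.choose_succ_succ,
      Nat.choose_symm_half]
    ring
  rw [medianProb, medianProb, e1, e2, h, show 2 * (j + 1) = (2 * j + 1) + 1 by ring,
    pow_succ (2 : ℝ) (2 * j + 1)]
  push_cast
  field_simp

/-- The left side is decreasing in `j`: successive ratios are `(2j+1)(2j+3)/(2j+2)^2`. -/
theorem medianProb_even_sq_le (j : ℕ) : medianProb (2 * j) ^ 2 * (2 * j + 1) ≤ 1 := by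
  induction j with
  | zero => simp [medianProb]
  | succ j ih =>
    have h := medianProb_two_mul_succ j
    have h0 : (0 : ℝ) ≤ j := Nat.cast_nonneg j
    set x := medianProb (2 * (j + 1))
    set y := medianProb (2 * j)
    have h1 : (x * (2 * (j + 1))) ^ 2 = (y ^ 2 * (2 * j + 1)) * (2 * j + 1) := by rw [h]; ring
    have h2 : x ^ 2 * (2 * ((j : ℝ) + 1)) ^ 2 ≤ 2 * j + 1 := by
      rw [← mul_pow, h1]
      exact mul_le_of_le_one_left (by positivity) ih
    have h3 : x ^ 2 * (2 * ((j + 1 : ℕ) : ℝ) + 1) * (2 * ((j : ℝ) + 1)) ^ 2 ≤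
        1 * (2 * ((j : ℝ) + 1)) ^ 2 := by
      push_cast
      nlinarith
    exact le_of_mul_le_mul_right h3 (by positivity)

/-- The product starts at equality and increases, with ratios `(2j+3)^2/(4(j+1)(j+2))`. -/
theorem one_le_medianProb_even_sq (j : ℕ) : 1 ≤ medianProb (2 * (j + 1)) ^ 2 * (4 * (j + 1)) := by
  induction j with
  | zero => norm_num [medianProb]
  | succ j ih =>
    have h := medianProb_two_mul_succ (j + 1)
    have h0 : (0 : ℝ) ≤ j := Nat.cast_nonneg j
    push_cast at h ⊢
    set x := medianProb (2 * (j + 1 + 1))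
    set y := medianProb (2 * (j + 1))
    have h1 : (x * (2 * (j + 1 + 1))) ^ 2 = y ^ 2 * (2 * (j + 1) + 1) ^ 2 := by rw [h]; ring
    nlinarith [sq_nonneg y]

theorem medianProb_sq_le (k : ℕ) : medianProb k ^ 2 * (k + 1) ≤ 1 := by
  rcases Nat.even_or_odd' k with ⟨j, rfl | rfl⟩
  · exact_mod_cast medianProb_even_sq_le j
  · rw [medianProb_odd]
    have := medianProb_even_sq_le (j + 1)
    push_cast at this ⊢
    nlinarith [sq_nonneg (medianProb (2 * (j + 1)))]

theorem one_le_medianProb_sq (k : ℕ) : 1 ≤ medianProb k ^ 2 * (2 * (k + 1)) := by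
  rcases Nat.even_or_odd' k with ⟨j, rfl | rfl⟩
  · rcases j with _ | j
    · norm_num [medianProb]
    · have := one_le_medianProb_even_sq j
      push_cast at this ⊢
      nlinarith [sq_nonneg (medianProb (2 * (j + 1)))]
  · rw [medianProb_odd]
    have := one_le_medianProb_even_sq j
    push_cast at this ⊢
    nlinarith [sq_nonneg (medianProb (2 * (j + 1)))]

theorem le_medianProb_mul_medianProb {k l n : ℕ} (hk : k ≤ n) (hl : l ≤ n) :
    1 / (2 * ((n : ℝ) + 1)) ≤ medianProb k * medianProb l := by
  have h1 := one_le_medianProb_sq k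
  have h2 := one_le_medianProb_sq l
  have hk' : (k : ℝ) ≤ n := by exact_mod_cast hk
  have hl' : (l : ℝ) ≤ n := by exact_mod_cast hl
  have h3 : 1 ≤ medianProb k ^ 2 * (2 * ((n : ℝ) + 1)) :=
    h1.trans (mul_le_mul_of_nonneg_left (by linarith) (sq_nonneg _))
  have h4 : 1 ≤ medianProb l ^ 2 * (2 * ((n : ℝ) + 1)) :=
    h2.trans (mul_le_mul_of_nonneg_left (by linarith) (sq_nonneg _))
  rw [div_le_iff₀ (by positivity)]
  rw [← one_le_sq_iff₀ (mul_nonneg (mul_nonneg (medianProb_nonneg k) (medianProb_nonneg l))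
    (by positivity))]
  calc (1 : ℝ) ≤ (medianProb k ^ 2 * (2 * ((n : ℝ) + 1))) * (medianProb l ^ 2 * (2 * ((n : ℝ) + 1))) :=
        one_le_mul_of_one_le_of_one_le h3 h4
    _ = _ := by ring

variable {ι : Type*} [DecidableEq ι]

/-- `1` on `Y` and `-1` off it. -/
def sgnOf (Y : Finset ι) (j : ι) : ℝ := if j ∈ Y then 1 else -1

/-- Pairing each set without `j` with the same set plus `j` turns the sign into a discrete
derivative of `f`. -/
theorem sum_powerset_sgnOf {T : Finset ι} {j : ι} (hj : j ∈ T) (f : ℕ → ℝ) :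
    ∑ Y ∈ T.powerset, f Y.card * sgnOf Y j =
      ∑ Z ∈ (T.erase j).powerset, (f (Z.card + 1) - f Z.card) := by
  conv_lhs => rw [← Finset.insert_erase hj]
  rw [Finset.sum_powerset_insert (Finset.notMem_erase j T), add_comm, Finset.sum_sub_distrib,
    sub_eq_add_neg, ← Finset.sum_neg_distrib]
  congr 1
  · refine Finset.sum_congr rfl fun Z hZ => ?_
    have : j ∉ Z := fun h => Finset.notMem_erase j T (Finset.mem_powerset.1 hZ h)
    rw [Finset.card_insert_of_notMem this, sgnOf, if_pos (Finset.mem_insert_self j Z), mul_one]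
  · refine Finset.sum_congr rfl fun Z hZ => ?_
    have : j ∉ Z := fun h => Finset.notMem_erase j T (Finset.mem_powerset.1 hZ h)
    rw [sgnOf, if_neg this]; ring

theorem sum_powerset_card_eq {ι : Type*} (T : Finset ι) (k : ℕ) :
    ∑ Z ∈ T.powerset, (if Z.card = k then (1 : ℝ) else 0) = T.card.choose k := by
  rw [Finset.sum_boole, ← Finset.powersetCard_eq_filter, Finset.card_powersetCard]

/-- The derivative of a threshold is concentrated at one level: a voter's sign matters only when the
other voters are at their median, that is, when the voter is pivotal. -/
theorem sum_powerset_minority {T : Finset ι} (w : ι → ℝ) :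
    ∑ Y ∈ T.powerset, (if 2 * Y.card < T.card then (1 : ℝ) else 0) * ∑ j ∈ T, sgnOf Y j * w j =
      -((T.card - 1).choose ((T.card - 1) / 2) * ∑ j ∈ T, w j) := by
  simp_rw [Finset.mul_sum]
  rw [Finset.sum_comm, ← Finset.sum_neg_distrib]
  refine Finset.sum_congr rfl fun j hj => ?_
  simp_rw [← mul_assoc]
  rw [← Finset.sum_mul, sum_powerset_sgnOf hj (fun k => if 2 * k < T.card then (1 : ℝ) else 0),
    ← neg_mul]
  congr 1
  rw [← Finset.card_erase_of_mem hj, ← sum_powerset_card_eq, ← Finset.sum_neg_distrib]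
  refine Finset.sum_congr rfl fun Z _ => ?_
  rw [Finset.card_erase_of_mem hj]
  have := Finset.card_pos.2 ⟨j, hj⟩
  split_ifs <;> first | omega | norm_num

theorem sum_powerset_majority {T : Finset ι} (w : ι → ℝ) :
    ∑ Y ∈ T.powerset, (if T.card < 2 * Y.card then (1 : ℝ) else 0) * ∑ j ∈ T, sgnOf Y j * w j =
      (T.card - 1).choose ((T.card - 1) / 2) * ∑ j ∈ T, w j := by
  simp_rw [Finset.mul_sum]
  rw [Finset.sum_comm]
  refine Finset.sum_congr rfl fun j hj => ?_
  simp_rw [← mul_assoc]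
  rw [← Finset.sum_mul, sum_powerset_sgnOf hj (fun k => if T.card < 2 * k then (1 : ℝ) else 0)]
  congr 1
  have := Finset.card_pos.2 ⟨j, hj⟩
  rw [← Nat.choose_symm_of_eq_add (show T.card - 1 = T.card / 2 + (T.card - 1) / 2 by omega),
    ← Finset.card_erase_of_mem hj, ← sum_powerset_card_eq]
  refine Finset.sum_congr rfl fun Z _ => ?_
  split_ifs <;> first | omega | norm_num

/-- On a level set every element has the same average sign, `(2k - |G|)/|G|`. It vanishes for an
exact half and is of order `1/|G|` at the lower median of an odd set. -/
theorem card_mul_sum_powerset_card_eq {G : Finset ι} (k : ℕ) (w : ι → ℝ) :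
    G.card * ∑ Y ∈ G.powerset, (if Y.card = k then (1 : ℝ) else 0) * ∑ j ∈ G, sgnOf Y j * w j =
      (2 * k - G.card) * G.card.choose k * ∑ j ∈ G, w j := by
  simp_rw [Finset.mul_sum]
  rw [Finset.sum_comm]
  refine Finset.sum_congr rfl fun j hj => ?_
  simp_rw [← mul_assoc]
  rw [← Finset.sum_mul]
  simp_rw [mul_assoc]
  rw [← Finset.mul_sum, sum_powerset_sgnOf hj (fun i => if i = k then (1 : ℝ) else 0), ← mul_assoc]
  congr 1
  rw [Finset.sum_sub_distrib, sum_powerset_card_eq]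
  have hg := Finset.card_erase_add_one hj
  rw [← hg]
  generalize hr : (G.erase j).card = r
  rcases k with _ | k
  · simp
  · simp only [Nat.add_right_cancel_iff]
    rw [sum_powerset_card_eq, hr]
    have h1 : ((r : ℝ) + 1) * r.choose k = (r + 1).choose (k + 1) * (k + 1) := by
      exact_mod_cast Nat.add_one_mul_choose_eq r k
    have h2 : ((r + 1).choose (k + 1) : ℝ) = r.choose k + r.choose (k + 1) := by
      exact_mod_cast Nat.choose_succ_succ r k
    push_cast
    linear_combination 2 * h1 + ((r : ℝ) + 1) * h2

end SignSums

/-! ### Symmetrisation by exchanging two alternatives in each ranking -/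

section Orientation

variable {m n : ℕ} [NeZero m]

/-- Exchange `p j` and `q j` in the ranking of every agent `j ∈ X`. -/
def exchange (p q : Fin n → Fin m) (X : Finset (Fin n)) (P : Profile m n) : Profile m n :=
  fun j => if j ∈ X then (Equiv.swap (p j) (q j)).trans (P j) else P j

/-- Exchange `p j` and `q j`, if necessary, so that precisely the agents in `Y` prefer `p j`. -/
def orient (p q : Fin n → Fin m) (P : Profile m n) (Y : Finset (Fin n)) : Profile m n :=
  exchange p q (symmDiff Y (Finset.univ.filter fun j => P j (p j) < P j (q j))) P

theorem exchange_involutive {m n : ℕ} (p q : Fin n → Fin m) (X : Finset (Fin n)) :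
    Function.Involutive (exchange p q X) := by
  intro P
  funext j
  by_cases h : j ∈ X
  · ext a
    simp [exchange, h]
  · simp [exchange, h]

/-- Each `exchange` is a bijection of profiles. For fixed `P`, symmetric difference with the agents
preferring `p j` reparametrises the exchanged sets by the resulting sets of supporters. -/
theorem expect_orient {m n : ℕ} (p q : Fin n → Fin m) (f : Profile m n → ℝ) :
    𝔼 P, f P = 𝔼 P, 𝔼 Y : Finset (Fin n), f (orient p q P Y) := by
  calc 𝔼 P, f P = 𝔼 _X : Finset (Fin n), 𝔼 P, f P := (Fintype.expect_const _).symm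
    _ = 𝔼 X : Finset (Fin n), 𝔼 P, f (exchange p q X P) :=
      Finset.expect_congr rfl fun X _ => (Fintype.expect_equiv
        (exchange_involutive p q X).toPerm _ _ fun P => rfl).symm
    _ = 𝔼 P, 𝔼 X : Finset (Fin n), f (exchange p q X P) := Finset.expect_comm _ _ _
    _ = _ := Finset.expect_congr rfl fun P _ => (Fintype.expect_equiv
        (symmDiff_left_involutive
          (Finset.univ.filter fun j => P j (p j) < P j (q j))).toPerm _ _ fun Y => rfl).symm

theorem orient_apply {m n : ℕ} (p q : Fin n → Fin m) (P : Profile m n) (Y : Finset (Fin n)) (j : Fin n) :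
    orient p q P Y j = if (j ∈ Y ↔ P j (p j) < P j (q j)) then P j
      else (Equiv.swap (p j) (q j)).trans (P j) := by
  simp only [orient, exchange, Finset.mem_symmDiff, Finset.mem_filter, Finset.mem_univ, true_and]
  by_cases h1 : j ∈ Y <;> by_cases h2 : P j (p j) < P j (q j) <;> simp [h1, h2]

theorem orient_lt_iff {m n : ℕ} {p q : Fin n → Fin m} (P : Profile m n) (Y : Finset (Fin n)) {j : Fin n}
    (h : p j ≠ q j) : orient p q P Y j (p j) < orient p q P Y j (q j) ↔ j ∈ Y := by
  have hne : P j (p j) ≠ P j (q j) := fun e => h ((P j).injective e)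
  rw [orient_apply]
  by_cases h1 : j ∈ Y <;> by_cases h2 : P j (p j) < P j (q j) <;> simp [h1, h2]
  · exact lt_of_le_of_ne (not_lt.1 h2) hne.symm
  · exact h2.le

theorem topRank_trans_swap (R : Ranking m) (a b : Fin m) :
    topRank ((Equiv.swap a b).trans R) = Equiv.swap a b (topRank R) := by
  simp [topRank]

theorem topRank_orient_of_ne {p q : Fin n → Fin m} (P : Profile m n) (Y : Finset (Fin n))
    {j : Fin n} (h : topRank (P j) ≠ p j ∧ topRank (P j) ≠ q j) :
    topRank (orient p q P Y j) = topRank (P j) := by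
  rw [orient_apply]
  split_ifs
  · rfl
  · rw [topRank_trans_swap, Equiv.swap_apply_of_ne_of_ne h.1 h.2]

theorem topRank_orient_mem_iff {p q : Fin n → Fin m} (P : Profile m n) (Y : Finset (Fin n))
    {j : Fin n} : (topRank (orient p q P Y j) = p j ∨ topRank (orient p q P Y j) = q j) ↔
      (topRank (P j) = p j ∨ topRank (P j) = q j) := by
  rw [orient_apply]
  split_ifs
  · rfl
  · rw [topRank_trans_swap, Equiv.swap_apply_eq_iff, Equiv.swap_apply_eq_iff,
      Equiv.swap_apply_left, Equiv.swap_apply_right, or_comm]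

theorem topRank_orient_eq_left_iff {p q : Fin n → Fin m} (P : Profile m n) (Y : Finset (Fin n))
    {j : Fin n} (h : p j ≠ q j) : topRank (orient p q P Y j) = p j ↔
      (topRank (P j) = p j ∨ topRank (P j) = q j) ∧ j ∈ Y := by
  rw [← topRank_orient_mem_iff P Y, ← orient_lt_iff P Y h]
  constructor
  · intro e
    exact ⟨Or.inl e, apply_lt_of_topRank_eq e h⟩
  · rintro ⟨e | e, hlt⟩
    · exact e
    · exact absurd (apply_lt_of_topRank_eq e h.symm) (not_lt.2 hlt.le)

theorem topRank_orient_eq_right_iff {p q : Fin n → Fin m} (P : Profile m n) (Y : Finset (Fin n))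
    {j : Fin n} (h : p j ≠ q j) : topRank (orient p q P Y j) = q j ↔
      (topRank (P j) = p j ∨ topRank (P j) = q j) ∧ j ∉ Y := by
  rw [← topRank_orient_mem_iff P Y, ← orient_lt_iff P Y h]
  constructor
  · intro e
    exact ⟨Or.inr e, not_lt.2 (apply_lt_of_topRank_eq e h.symm).le⟩
  · rintro ⟨e | e, hlt⟩
    · exact absurd (apply_lt_of_topRank_eq e h) hlt
    · exact e

theorem topRank_orient_eq_of_ne_iff {p q : Fin n → Fin m} (P : Profile m n) (Y : Finset (Fin n))
    {j : Fin n} {c : Fin m} (hp : c ≠ p j) (hq : c ≠ q j) :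
    topRank (orient p q P Y j) = c ↔ topRank (P j) = c := by
  by_cases h : topRank (P j) = p j ∨ topRank (P j) = q j
  · have h' := (topRank_orient_mem_iff P Y).2 h
    constructor
    · rintro rfl; tauto
    · rintro rfl; tauto
  · rw [topRank_orient_of_ne P Y (by tauto)]

theorem utility_sub_orient {m n : ℕ} {u : Fin m → ℝ} (hu : Antitone u) {a b : Fin m} (hab : a ≠ b)
    (P : Profile m n) (Y : Finset (Fin n)) (j : Fin n) :
    u (orient (fun _ => a) (fun _ => b) P Y j a) - u (orient (fun _ => a) (fun _ => b) P Y j b) =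
      sgnOf Y j * |u (P j a) - u (P j b)| := by
  have habs : |u (orient (fun _ => a) (fun _ => b) P Y j a) -
      u (orient (fun _ => a) (fun _ => b) P Y j b)| = |u (P j a) - u (P j b)| := by
    rw [orient_apply]
    split_ifs
    · rfl
    · simp [abs_sub_comm]
  rw [← habs]
  have h := orient_lt_iff (p := fun _ => a) (q := fun _ => b) P Y (j := j) hab
  rw [sgnOf]
  split_ifs with hj
  · have := hu (h.2 hj).le
    rw [abs_of_nonneg (by linarith)]; ring
  · have := hu (not_lt.1 (mt h.1 hj))
    rw [abs_of_nonpos (by linarith)]; ring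

/-- The agents whose top alternative is `a` or `b`. -/
def backers (P : Profile m n) (a b : Fin m) : Finset (Fin n) :=
  Finset.univ.filter fun j => topRank (P j) = a ∨ topRank (P j) = b

theorem pluralityScore_orient_left {a b : Fin m} (hab : a ≠ b) (P : Profile m n)
    (Y : Finset (Fin n)) :
    pluralityScore (orient (fun _ => a) (fun _ => b) P Y) a = (Y ∩ backers P a b).card := by
  rw [pluralityScore]
  congr 1
  ext j
  simp only [Finset.mem_filter, Finset.mem_univ, true_and, Finset.mem_inter, backers]
  rw [and_comm]
  exact topRank_orient_eq_left_iff (p := fun _ => a) (q := fun _ => b) P Y hab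

theorem pluralityScore_orient_right {a b : Fin m} (hab : a ≠ b) (P : Profile m n)
    (Y : Finset (Fin n)) :
    pluralityScore (orient (fun _ => a) (fun _ => b) P Y) b = (backers P a b \ Y).card := by
  rw [pluralityScore]
  congr 1
  ext j
  simp only [Finset.mem_filter, Finset.mem_univ, true_and, Finset.mem_sdiff, backers]
  exact topRank_orient_eq_right_iff (p := fun _ => a) (q := fun _ => b) P Y hab

theorem pluralityScore_orient_of_ne {a b c : Fin m} (ha : c ≠ a) (hb : c ≠ b) (P : Profile m n)
    (Y : Finset (Fin n)) :
    pluralityScore (orient (fun _ => a) (fun _ => b) P Y) c = pluralityScore P c := by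
  rw [pluralityScore, pluralityScore]
  congr 1
  ext j
  simp only [Finset.mem_filter, Finset.mem_univ, true_and]
  exact topRank_orient_eq_of_ne_iff (p := fun _ => a) (q := fun _ => b) P Y ha hb

theorem pluralityScore_add {a b : Fin m} (hab : a ≠ b) (P : Profile m n) :
    pluralityScore P a + pluralityScore P b = (backers P a b).card := by
  rw [pluralityScore, pluralityScore, backers, Finset.filter_or, Finset.card_union_of_disjoint]
  refine Finset.disjoint_filter.2 fun j _ h h' => hab (h.symm.trans h')

theorem pluralityScore_orient_add {a b : Fin m} (hab : a ≠ b) (P : Profile m n)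
    (Y : Finset (Fin n)) :
    pluralityScore (orient (fun _ => a) (fun _ => b) P Y) a +
      pluralityScore (orient (fun _ => a) (fun _ => b) P Y) b = (backers P a b).card := by
  rw [pluralityScore_orient_left hab, pluralityScore_orient_right hab, Finset.inter_comm,
    Finset.card_inter_add_card_sdiff]

theorem leadsJointly_orient {a b : Fin m} (hab : a ≠ b) (P : Profile m n) (Y : Finset (Fin n)) :
    LeadsJointly (orient (fun _ => a) (fun _ => b) P Y) a b ↔ LeadsJointly P a b := by
  have key : ∀ c, c ≠ a → c ≠ b →
      (pluralityScore (orient (fun _ => a) (fun _ => b) P Y) c + 2 ≤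
        (pluralityScore (orient (fun _ => a) (fun _ => b) P Y) a +
          pluralityScore (orient (fun _ => a) (fun _ => b) P Y) b + 1) / 2 ↔
      pluralityScore P c + 2 ≤ (pluralityScore P a + pluralityScore P b + 1) / 2) := by
    intro c ha hb
    rw [pluralityScore_orient_of_ne ha hb, pluralityScore_orient_add hab, pluralityScore_add hab]
  exact ⟨fun h => ⟨h.lt, fun c ha hb => (key c ha hb).1 (h.others c ha hb)⟩,
    fun h => ⟨h.lt, fun c ha hb => (key c ha hb).2 (h.others c ha hb)⟩⟩

theorem supporters_orient_left {m n : ℕ} {a b : Fin m} (hab : a ≠ b) (P : Profile m n)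
    (Y : Finset (Fin n)) :
    supporters (orient (fun _ => a) (fun _ => b) P Y) a b = Y.card := by
  rw [supporters]
  congr 1
  ext j
  simp only [Finset.mem_filter, Finset.mem_univ, true_and]
  exact orient_lt_iff (p := fun _ => a) (q := fun _ => b) P Y hab

theorem supporters_orient_right {m n : ℕ} {a b : Fin m} (hab : a ≠ b) (P : Profile m n)
    (Y : Finset (Fin n)) :
    supporters (orient (fun _ => a) (fun _ => b) P Y) b a = Yᶜ.card := by
  rw [supporters]
  congr 1
  ext j
  simp only [Finset.mem_filter, Finset.mem_univ, true_and, Finset.mem_compl]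
  rw [← orient_lt_iff (p := fun _ => a) (q := fun _ => b) P Y (j := j) hab, not_lt]
  exact ⟨le_of_lt, fun h => lt_of_le_of_ne h fun e => hab ((Equiv.injective _) e).symm⟩

theorem socialWelfare_sub_orient {m n : ℕ} {u : Fin m → ℝ} (hu : Antitone u) {a b : Fin m} (hab : a ≠ b)
    (P : Profile m n) (Y : Finset (Fin n)) :
    socialWelfare u (orient (fun _ => a) (fun _ => b) P Y) a -
      socialWelfare u (orient (fun _ => a) (fun _ => b) P Y) b =
      ∑ j, sgnOf Y j * |u (P j a) - u (P j b)| := by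
  rw [socialWelfare, socialWelfare, ← Finset.sum_sub_distrib]
  exact Finset.sum_congr rfl fun j _ => utility_sub_orient hu hab P Y j

end Orientation

/-! ### The average duel loss over orientations -/

section DuelAverage

variable {m n : ℕ} [NeZero m]

theorem sum_sgnOf_eq_add (G Y : Finset (Fin n)) (w : Fin n → ℝ) :
    ∑ j, sgnOf Y j * w j =
      ∑ j ∈ G, sgnOf (Y ∩ G) j * w j + ∑ j ∈ Finset.univ \ G, sgnOf (Y \ G) j * w j := by
  rw [← Finset.sum_sdiff (Finset.subset_univ G), add_comm]
  congr 1
  · refine Finset.sum_congr rfl fun j hj => ?_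
    simp [sgnOf, hj]
  · refine Finset.sum_congr rfl fun j hj => ?_
    simp only [sgnOf, Finset.mem_sdiff, (Finset.mem_sdiff.1 hj).2, not_false_eq_true, and_true]

-- Once the backers split at the median, the parity of their number fixes the truthful winner, and
-- the non-backers' majority alone decides whether it is replaced.
open scoped Classical in
theorem duelLoss_orient {u : Fin m → ℝ} (hu : Antitone u) {a b : Fin m} (hab : a ≠ b)
    (P : Profile m n) (Y : Finset (Fin n)) :
    (if IsDuel (orient (fun _ => a) (fun _ => b) P Y) a b then
      duelLoss u (orient (fun _ => a) (fun _ => b) P Y) a b else 0) =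
    if LeadsJointly P a b then
      (if (Y ∩ backers P a b).card = (backers P a b).card / 2 then (1 : ℝ) else 0) *
      (if (backers P a b).card % 2 = 0 then
        (if 2 * (Y \ backers P a b).card < (Finset.univ \ backers P a b).card then (1 : ℝ) else 0)
        else -(if (Finset.univ \ backers P a b).card < 2 * (Y \ backers P a b).card
          then (1 : ℝ) else 0)) *
      (∑ j ∈ backers P a b, sgnOf (Y ∩ backers P a b) j * |u (P j a) - u (P j b)| +
        ∑ j ∈ Finset.univ \ backers P a b,
          sgnOf (Y \ backers P a b) j * |u (P j a) - u (P j b)|)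
    else 0 := by
  rw [← sum_sgnOf_eq_add, ← socialWelfare_sub_orient hu hab]
  simp only [isDuel_iff, leadsJointly_orient hab, duelLoss, supporters_orient_left hab,
    supporters_orient_right hab]
  have hL := pluralityScore_orient_left hab P Y
  have hR := pluralityScore_orient_right hab P Y
  have hsum := pluralityScore_orient_add hab P Y
  set P' := orient (fun _ => a) (fun _ => b) P Y
  rw [hsum, ← hL]
  have hY := Finset.card_inter_add_card_sdiff Y (backers P a b)
  have hYc := Finset.card_add_card_compl Y
  have hG := Finset.card_sdiff_add_card_eq_card (Finset.subset_univ (backers P a b))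
  rw [Finset.card_univ] at hG
  rw [← hL] at hY
  generalize Yᶜ.card = yc at *
  generalize Y.card = y at *
  generalize (Y \ backers P a b).card = z at *
  generalize (Finset.univ \ backers P a b).card = t at *
  generalize (backers P a b).card = g at *
  generalize pluralityScore P' a = s at *
  generalize pluralityScore P' b = s' at *
  generalize Fintype.card (Fin n) = n' at *
  by_cases h1 : LeadsJointly P a b
  · by_cases h2 : s = g / 2
    · simp only [h1, h2, and_self, if_true, one_mul]
      by_cases h3 : g % 2 = 0
      · have e1 : s' = g / 2 := by omega
        rw [if_pos e1, if_pos h3]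
        have e2 : y < yc ↔ 2 * z < t := by omega
        simp only [e2]
        split_ifs <;> ring
      · have e1 : ¬ s' = g / 2 := by omega
        rw [if_neg e1, if_neg h3]
        -- Now `b` wins truthfully with one extra backer, so `a` takes over only with a strict
        -- majority of the non-backers; their tie leaves `b` the winner.
        have e2 : y < yc ↔ ¬ t < 2 * z := by omega
        simp only [e2]
        split_ifs <;> ring
    · simp [h1, h2]
  · simp [h1]

/-- The choices inside and outside `G` factor. The outside signs give the negative main term. The
inside signs cancel for even `|G|`, and for odd `|G|` the single unpaired backer costs at most `U`
on average. -/
theorem sum_duel_signs_le {S G : Finset (Fin n)} (hG : G ⊆ S) (w : Fin n → ℝ) {U : ℝ}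
    (hU : ∀ j, w j ≤ U) :
    ∑ Y ∈ S.powerset, (if (Y ∩ G).card = G.card / 2 then (1 : ℝ) else 0) *
      (if G.card % 2 = 0 then (if 2 * (Y \ G).card < (S \ G).card then (1 : ℝ) else 0)
        else -(if (S \ G).card < 2 * (Y \ G).card then (1 : ℝ) else 0)) *
      (∑ j ∈ G, sgnOf (Y ∩ G) j * w j + ∑ j ∈ S \ G, sgnOf (Y \ G) j * w j) ≤
    (G.card.choose (G.card / 2) : ℝ) *
      (-(((S \ G).card - 1).choose (((S \ G).card - 1) / 2) * ∑ j ∈ S \ G, w j) +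
        2 ^ (S \ G).card * max U 0) := by
  set T := S \ G with hT
  set s : Finset (Fin n) → ℝ := fun B => if G.card % 2 = 0 then
    (if 2 * B.card < T.card then (1 : ℝ) else 0)
    else -(if T.card < 2 * B.card then (1 : ℝ) else 0) with hs
  rw [Finset.sum_powerset_inter_sdiff hG (fun A B => (if A.card = G.card / 2 then (1 : ℝ) else 0) *
    s B * (∑ j ∈ G, sgnOf A j * w j + ∑ j ∈ T, sgnOf B j * w j))]
  have hsplit : ∑ A ∈ G.powerset, ∑ B ∈ T.powerset,
      (if A.card = G.card / 2 then (1 : ℝ) else 0) *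
        s B * (∑ j ∈ G, sgnOf A j * w j + ∑ j ∈ T, sgnOf B j * w j) =
      (∑ A ∈ G.powerset, (if A.card = G.card / 2 then (1 : ℝ) else 0)) *
        (∑ B ∈ T.powerset, s B * ∑ j ∈ T, sgnOf B j * w j) +
      (∑ A ∈ G.powerset, (if A.card = G.card / 2 then (1 : ℝ) else 0) *
        ∑ j ∈ G, sgnOf A j * w j) * (∑ B ∈ T.powerset, s B) := by
    rw [Finset.sum_mul_sum, Finset.sum_mul_sum, ← Finset.sum_add_distrib]
    refine Finset.sum_congr rfl fun A _ => ?_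
    rw [← Finset.sum_add_distrib]
    exact Finset.sum_congr rfl fun B _ => by ring
  rw [hsplit, sum_powerset_card_eq, mul_add]
  have hmain : ∑ B ∈ T.powerset, s B * ∑ j ∈ T, sgnOf B j * w j =
      -((T.card - 1).choose ((T.card - 1) / 2) * ∑ j ∈ T, w j) := by
    simp only [hs]
    by_cases h : G.card % 2 = 0
    · simp only [h, if_true]
      exact sum_powerset_minority w
    · simp only [h, if_false, neg_mul, Finset.sum_neg_distrib]
      rw [sum_powerset_majority w]
  rw [hmain]
  refine add_le_add le_rfl ?_
  have hX := card_mul_sum_powerset_card_eq (G := G) (G.card / 2) w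
  set X := ∑ A ∈ G.powerset, (if A.card = G.card / 2 then (1 : ℝ) else 0) *
        ∑ j ∈ G, sgnOf A j * w j
  have hC : (0 : ℝ) ≤ G.card.choose (G.card / 2) := Nat.cast_nonneg _
  have hrhs : 0 ≤ (G.card.choose (G.card / 2) : ℝ) * (2 ^ T.card * max U 0) := by positivity
  rcases Nat.eq_zero_or_pos G.card with h0 | h0
  · have : X = 0 := by
      have hG0 : G = ∅ := Finset.card_eq_zero.1 h0
      simp only [X, hG0, Finset.sum_empty, mul_zero, Finset.sum_const_zero]
    rw [this, zero_mul]; exact hrhs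
  have hgpos : (0 : ℝ) < G.card := by exact_mod_cast h0
  by_cases h : G.card % 2 = 0
  · have e : (2 : ℝ) * ((G.card / 2 : ℕ) : ℝ) = G.card := by
      exact_mod_cast (show 2 * (G.card / 2) = G.card by omega)
    rw [e, sub_self, zero_mul, zero_mul] at hX
    have : X = 0 := (mul_eq_zero.1 hX).resolve_left hgpos.ne'
    rw [this, zero_mul]; exact hrhs
  · have e : (2 : ℝ) * ((G.card / 2 : ℕ) : ℝ) + 1 = G.card := by
      exact_mod_cast (show 2 * (G.card / 2) + 1 = G.card by omega)
    have e' : (2 : ℝ) * ((G.card / 2 : ℕ) : ℝ) - G.card = -1 := by linarith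
    rw [e'] at hX
    have hW : ∑ j ∈ G, w j ≤ G.card * max U 0 := by
      rw [← nsmul_eq_mul]
      exact Finset.sum_le_card_nsmul _ _ _ fun j _ => (hU j).trans (le_max_left _ _)
    have hX' : -((G.card.choose (G.card / 2) : ℝ) * max U 0) ≤ X := by
      refine le_of_mul_le_mul_left ?_ hgpos
      rw [hX]
      nlinarith [mul_le_mul_of_nonneg_left hW hC]
    obtain ⟨N, hN0, hN1, hN⟩ : ∃ N : ℝ, 0 ≤ N ∧ N ≤ 2 ^ T.card ∧ ∑ B ∈ T.powerset, s B = -N := by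
      refine ⟨∑ B ∈ T.powerset, (if T.card < 2 * B.card then (1 : ℝ) else 0),
        Finset.sum_nonneg fun _ _ => by split_ifs <;> norm_num, ?_, ?_⟩
      · calc _ ≤ ∑ B ∈ T.powerset, (1 : ℝ) :=
              Finset.sum_le_sum fun _ _ => by split_ifs <;> norm_num
          _ = _ := by simp
      · simp [hs, h]
    rw [hN]
    have hM : 0 ≤ max U 0 := le_max_right _ _
    calc X * -N = (-X) * N := by ring
      _ ≤ ((G.card.choose (G.card / 2) : ℝ) * max U 0) * N :=
        mul_le_mul_of_nonneg_right (by linarith) hN0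
      _ ≤ ((G.card.choose (G.card / 2) : ℝ) * max U 0) * 2 ^ T.card :=
        mul_le_mul_of_nonneg_left hN1 (by positivity)
      _ = _ := by ring

open scoped Classical in
/-- The average of the duel loss over all orientations of `a` and `b`. -/
theorem expect_duelLoss_orient_le {u : Fin m → ℝ} (hu : IsUtilityVector u) {a b : Fin m}
    (hab : a ≠ b) (P : Profile m n) :
    𝔼 Y, (if IsDuel (orient (fun _ => a) (fun _ => b) P Y) a b then
      duelLoss u (orient (fun _ => a) (fun _ => b) P Y) a b else 0) ≤
    (if LeadsJointly P a b then -(1 / (4 * ((n : ℝ) + 1)) *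
      ∑ j ∈ Finset.univ \ backers P a b, |u (P j a) - u (P j b)|) else 0) +
      u 0 * medianProb (backers P a b).card := by
  have hu0 : 0 ≤ u 0 := hu.nonneg 0
  have hq := medianProb_nonneg (backers P a b).card
  simp only [duelLoss_orient hu.antitone hab]
  by_cases hL : LeadsJointly P a b
  swap
  · simp only [hL, if_false, Finset.expect_const_zero, zero_add]
    positivity
  simp only [hL, if_true]
  have hw : ∀ j, |u (P j a) - u (P j b)| ≤ u 0 := fun j => by
    have h1 := hu.antitone (Fin.zero_le (P j a))
    have h2 := hu.antitone (Fin.zero_le (P j b))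
    have h3 := hu.nonneg (P j a)
    have h4 := hu.nonneg (P j b)
    rw [abs_le]; constructor <;> linarith
  have key := sum_duel_signs_le (Finset.subset_univ (backers P a b))
    (fun j => |u (P j a) - u (P j b)|) hw
  rw [Finset.powerset_univ, max_eq_left hu0] at key
  rw [Fintype.expect_eq_sum_div_card, Fintype.card_finset, Fintype.card_fin]
  have hG := Finset.card_sdiff_add_card_eq_card (Finset.subset_univ (backers P a b))
  rw [Finset.card_univ, Fintype.card_fin] at hG
  have hpow : (2 : ℝ) ^ n = 2 ^ (backers P a b).card * 2 ^ (Finset.univ \ backers P a b).card := by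
    rw [← pow_add]
    congr 1
    omega
  push_cast
  rw [div_le_iff₀ (by positivity)]
  refine key.trans ?_
  rw [hpow]
  have hC : ((backers P a b).card.choose ((backers P a b).card / 2) : ℝ) =
    2 ^ (backers P a b).card * medianProb (backers P a b).card := by
    rw [medianProb, mul_div_cancel₀ _ (by positivity)]
  have hWnn : 0 ≤ ∑ j ∈ Finset.univ \ backers P a b, |u (P j a) - u (P j b)| :=
    Finset.sum_nonneg fun _ _ => abs_nonneg _
  rcases Nat.eq_zero_or_pos (Finset.univ \ backers P a b).card with h0 | h0
  · have hW0 : ∑ j ∈ Finset.univ \ backers P a b, |u (P j a) - u (P j b)| = 0 := by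
      rw [Finset.card_eq_zero.1 h0, Finset.sum_empty]
    rw [hW0, hC]
    apply le_of_eq
    ring
  · obtain ⟨k, hk⟩ : ∃ k, (Finset.univ \ backers P a b).card = k + 1 := Nat.exists_eq_add_one.2 h0
    have hgn : (backers P a b).card ≤ n := by omega
    have hkn : k ≤ n := by omega
    have hmed := le_medianProb_mul_medianProb hgn hkn
    rw [hk, Nat.add_sub_cancel, hC]
    have hC' : (k.choose (k / 2) : ℝ) = 2 ^ k * medianProb k := by
      rw [medianProb, mul_div_cancel₀ _ (by positivity)]
    rw [hC', pow_succ]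
    set W := ∑ j ∈ Finset.univ \ backers P a b, |u (P j a) - u (P j b)|
    -- The extra half arises because the pivotal count runs over `k` agents while the average is
    -- over subsets of `k + 1`.
    have h4 : 1 / (4 * ((n : ℝ) + 1)) = 1 / (2 * ((n : ℝ) + 1)) / 2 := by field_simp; norm_num
    rw [h4]
    have h5 := mul_le_mul_of_nonneg_right hmed hWnn
    have h6 : (0 : ℝ) ≤ 2 ^ (backers P a b).card * 2 ^ k := by positivity
    have h7 := mul_le_mul_of_nonneg_left h5 h6
    linear_combination h7

end DuelAverage

/-! ### Moments of independent centred sums -/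

section Moments

variable {α : Type*} [Fintype α]

theorem expect_fin_succ {n : ℕ} (F : (Fin (n + 1) → α) → ℝ) :
    𝔼 P, F P = 𝔼 x, 𝔼 P : Fin n → α, F (Fin.cons x P) := by
  rw [← Finset.expect_product' Finset.univ Finset.univ (fun x P => F (Fin.cons x P))]
  exact (Fintype.expect_equiv (Fin.consEquiv fun _ => α) _ _ fun _ => rfl).symm

variable [Nonempty α]

theorem expect_sum_eq_zero {n : ℕ} {f : Fin n → α → ℝ} (h0 : ∀ j, 𝔼 x, f j x = 0) :
    𝔼 P : Fin n → α, ∑ j, f j (P j) = 0 := by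
  induction n with
  | zero => simp
  | succ n ih =>
    rw [expect_fin_succ]
    simp only [Fin.sum_univ_succ, Fin.cons_zero, Fin.cons_succ, Finset.expect_add_distrib,
      Fintype.expect_const, h0, ih fun j => h0 j.succ, add_zero]

theorem expect_sum_sq_le {n : ℕ} {f : Fin n → α → ℝ} {U : ℝ} (h0 : ∀ j, 𝔼 x, f j x = 0)
    (hU : ∀ j x, |f j x| ≤ U) : 𝔼 P : Fin n → α, (∑ j, f j (P j)) ^ 2 ≤ n * U ^ 2 := by
  induction n with
  | zero => simp
  | succ n ih =>
    rw [expect_fin_succ]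
    have h1 := expect_sum_eq_zero fun j : Fin n => h0 j.succ
    have h2 := ih (fun j => h0 j.succ) fun j => hU j.succ
    have h3 : 𝔼 x, f 0 x ^ 2 ≤ U ^ 2 := by
      refine Finset.expect_le Finset.univ_nonempty fun x _ => ?_
      exact sq_le_sq' (neg_le_of_abs_le (hU 0 x)) (le_of_abs_le (hU 0 x))
    calc 𝔼 x, 𝔼 P : Fin n → α, (∑ j, f j (Fin.cons (α := fun _ => α) x P j)) ^ 2
        = 𝔼 x, f 0 x ^ 2 + 𝔼 P : Fin n → α, (∑ j, f j.succ (P j)) ^ 2 := by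
          simp only [Fin.sum_univ_succ, Fin.cons_zero, Fin.cons_succ, add_sq,
            Finset.expect_add_distrib, Fintype.expect_const, ← Finset.mul_expect, h1, mul_zero,
            add_zero]
      _ ≤ _ := by push_cast; linarith

/-- Splitting off one coordinate kills the terms containing a first power. The rest closes since `1
+ 6n + 3n^2 ≤ 3(n+1)^2`. -/
theorem expect_sum_pow_four_le {n : ℕ} {f : Fin n → α → ℝ} {U : ℝ} (h0 : ∀ j, 𝔼 x, f j x = 0)
    (hU : ∀ j x, |f j x| ≤ U) :
    𝔼 P : Fin n → α, (∑ j, f j (P j)) ^ 4 ≤ 3 * (n : ℝ) ^ 2 * U ^ 4 := by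
  induction n with
  | zero => simp
  | succ n ih =>
    rw [expect_fin_succ]
    have h1 := expect_sum_eq_zero fun j : Fin n => h0 j.succ
    have h2 := expect_sum_sq_le (fun j : Fin n => h0 j.succ) fun j => hU j.succ
    have h3 := ih (fun j => h0 j.succ) fun j => hU j.succ
    have hsq : ∀ x, f 0 x ^ 2 ≤ U ^ 2 := fun x =>
      sq_le_sq' (neg_le_of_abs_le (hU 0 x)) (le_of_abs_le (hU 0 x))
    have h4 : 𝔼 x, f 0 x ^ 2 ≤ U ^ 2 := Finset.expect_le Finset.univ_nonempty fun x _ => hsq x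
    have h5 : 𝔼 x, f 0 x ^ 4 ≤ U ^ 4 := by
      refine Finset.expect_le Finset.univ_nonempty fun x _ => ?_
      have := pow_le_pow_left₀ (sq_nonneg _) (hsq x) 2
      calc f 0 x ^ 4 = (f 0 x ^ 2) ^ 2 := by ring
        _ ≤ _ := this
        _ = _ := by ring
    have hnn : 0 ≤ 𝔼 P : Fin n → α, (∑ j, f j.succ (P j)) ^ 2 :=
      Finset.expect_nonneg fun _ _ => sq_nonneg _
    have hexp : ∀ a b : ℝ, (a + b) ^ 4 =
        a ^ 4 + 4 * a ^ 3 * b + 6 * a ^ 2 * b ^ 2 + 4 * a * b ^ 3 + b ^ 4 := fun a b => by ring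
    calc 𝔼 x, 𝔼 P : Fin n → α, (∑ j, f j (Fin.cons (α := fun _ => α) x P j)) ^ 4
        = 𝔼 x, f 0 x ^ 4 +
          6 * ((𝔼 x, f 0 x ^ 2) * 𝔼 P : Fin n → α, (∑ j, f j.succ (P j)) ^ 2) +
          𝔼 P : Fin n → α, (∑ j, f j.succ (P j)) ^ 4 := by
          simp only [Fin.sum_univ_succ, Fin.cons_zero, Fin.cons_succ, hexp,
            Finset.expect_add_distrib, Fintype.expect_const, ← Finset.mul_expect, h1, mul_zero,
            add_zero, ← Finset.expect_mul, h0, zero_mul]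
          ring
      _ ≤ U ^ 4 + 6 * (U ^ 2 * (n * U ^ 2)) + 3 * (n : ℝ) ^ 2 * U ^ 4 := by
          refine add_le_add (add_le_add h5 ?_) h3
          refine mul_le_mul_of_nonneg_left ?_ (by norm_num)
          exact mul_le_mul h4 h2 hnn (sq_nonneg U)
      _ ≤ _ := by
          push_cast
          have : 0 ≤ U ^ 4 := by positivity
          linear_combination 2 * this

theorem expect_abs_sum_le {n : ℕ} {f : Fin n → α → ℝ} {U r : ℝ} (h0 : ∀ j, 𝔼 x, f j x = 0)
    (hU : ∀ j x, |f j x| ≤ U) (hr : 0 < r) :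
    𝔼 P : Fin n → α, |∑ j, f j (P j)| ≤ r + n * U ^ 2 / r := by
  calc 𝔼 P : Fin n → α, |∑ j, f j (P j)| ≤
      𝔼 P : Fin n → α, (r + (∑ j, f j (P j)) ^ 2 / r) := by
        refine Finset.expect_le_expect fun P _ => ?_
        set S := ∑ j, f j (P j)
        have h1 : r + S ^ 2 / r - |S| = ((|S| - r / 2) ^ 2 + 3 / 4 * r ^ 2) / r := by
          rw [← sq_abs S]; field_simp; ring
        have h2 : 0 ≤ r + S ^ 2 / r - |S| := by rw [h1]; positivity
        linarith
    _ = r + (𝔼 P : Fin n → α, (∑ j, f j (P j)) ^ 2) / r := by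
        rw [Finset.expect_add_distrib, Fintype.expect_const, Finset.expect_div]
    _ ≤ _ := by
        gcongr
        exact expect_sum_sq_le h0 hU

theorem expect_inv_card_filter_le [DecidableEq α] {n : ℕ} (hn : 0 < n) {J : Finset (Fin n)}
    (hJ : n ≤ 3 * J.card) {A : Finset α} (hA : A.Nonempty) :
    𝔼 P : Fin n → α, 1 / (((J.filter fun j => P j ∈ A).card : ℝ) + 1) ≤
      42 * (Fintype.card α : ℝ) ^ 2 / n := by
  set p : ℝ := 𝔼 x, if x ∈ A then (1 : ℝ) else 0 with hp
  have hc : (0 : ℝ) < Fintype.card α := by exact_mod_cast Fintype.card_pos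
  have hpc : 1 ≤ Fintype.card α * p := by
    rw [hp, Fintype.card_mul_expect, Finset.sum_boole]
    simpa using hA
  have hp0 : 0 < p := by
    by_contra! h
    have := mul_nonpos_of_nonneg_of_nonpos hc.le h
    linarith
  have hp1 : p ≤ 1 := Finset.expect_le Finset.univ_nonempty fun x _ => by
    split_ifs <;> norm_num
  have hn0 : (0 : ℝ) < n := by exact_mod_cast hn
  have hJ' : (n : ℝ) ≤ 3 * J.card := by exact_mod_cast hJ
  set f : Fin n → α → ℝ := fun j x => if j ∈ J then (if x ∈ A then (1 : ℝ) else 0) - p else 0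
    with hf
  have h0 : ∀ j, 𝔼 x, f j x = 0 := by
    intro j
    simp only [hf]
    split_ifs
    · rw [Finset.expect_sub_distrib, Fintype.expect_const, sub_self]
    · simp
  have hU : ∀ j x, |f j x| ≤ 1 := by
    intro j x
    simp only [hf]
    split_ifs <;> rw [abs_le] <;> constructor <;> linarith
  have hsum : ∀ P : Fin n → α, ∑ j, f j (P j) =
      ((J.filter fun j => P j ∈ A).card : ℝ) - p * J.card := by
    intro P
    simp only [hf, Finset.sum_ite_mem, Finset.univ_inter, Finset.sum_sub_distrib,
      Finset.sum_boole, Finset.sum_const, nsmul_eq_mul]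
    ring
  have hsq := expect_sum_sq_le h0 hU
  simp only [hsum] at hsq
  set μ : ℝ := p * J.card with hμ
  have hμn : p * n ≤ 3 * μ := by rw [hμ]; nlinarith
  have hμ0 : 0 < μ := by nlinarith [mul_pos hp0 hn0]
  -- Chebyshev in pointwise form: either the count is at least half its mean `μ`, or the quadratic
  -- term already exceeds one.
  have hpt : ∀ g : ℝ, 0 ≤ g → 1 / (g + 1) ≤ 2 / μ + 4 / μ ^ 2 * (g - μ) ^ 2 := by
    intro g hg
    by_cases h : μ / 2 ≤ g
    · have h1 : 1 / (g + 1) ≤ 2 / μ := by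
        rw [div_le_div_iff₀ (by positivity) hμ0]; linarith
      have : 0 ≤ 4 / μ ^ 2 * (g - μ) ^ 2 := by positivity
      linarith
    · push Not at h
      have h1 : 1 / (g + 1) ≤ 1 := by rw [div_le_one (by positivity)]; linarith
      have h2 : 1 ≤ 4 / μ ^ 2 * (g - μ) ^ 2 := by
        rw [div_mul_eq_mul_div, le_div_iff₀ (by positivity)]
        nlinarith
      have : 0 ≤ 2 / μ := by positivity
      linarith
  calc 𝔼 P : Fin n → α, 1 / (((J.filter fun j => P j ∈ A).card : ℝ) + 1)
      ≤ 𝔼 P : Fin n → α,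
        (2 / μ + 4 / μ ^ 2 * (((J.filter fun j => P j ∈ A).card : ℝ) - μ) ^ 2) :=
        Finset.expect_le_expect fun P _ => hpt _ (Nat.cast_nonneg _)
    _ = 2 / μ + 4 / μ ^ 2 *
        𝔼 P : Fin n → α, (((J.filter fun j => P j ∈ A).card : ℝ) - μ) ^ 2 := by
        rw [Finset.expect_add_distrib, Fintype.expect_const, Finset.mul_expect]
    _ ≤ 2 / μ + 4 / μ ^ 2 * (n * 1 ^ 2) := by gcongr
    _ ≤ 6 / (p * n) + 36 / (p * n) ^ 2 * n := by
        have hpn : 0 < p * n := mul_pos hp0 hn0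
        have e1 : 2 / μ ≤ 6 / (p * n) := by
          rw [div_le_div_iff₀ hμ0 hpn]; linarith
        have e2 : 4 / μ ^ 2 ≤ 36 / (p * n) ^ 2 := by
          rw [div_le_div_iff₀ (by positivity) (by positivity)]
          nlinarith
        rw [one_pow, mul_one]
        gcongr
    _ = (6 * (1 / p) + 36 * (1 / p) ^ 2) / n := by field_simp
    _ ≤ _ := by
        have h1 : 1 / p ≤ Fintype.card α := by rw [div_le_iff₀ hp0]; exact hpc
        have h2 : 1 ≤ 1 / p := by rw [le_div_iff₀ hp0]; linarith
        gcongr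
        nlinarith

end Moments

/-! ### Near triples are rare -/

section NearTriples

variable {m n : ℕ} [NeZero m]

theorem expect_card_inter_eq_le {ι : Type*} [Fintype ι] [DecidableEq ι] {G H : Finset ι}
    (hGH : Disjoint G H) (k l : ℕ) :
    𝔼 Y : Finset ι, (if (Y ∩ G).card = k ∧ (Y ∩ H).card = l then (1 : ℝ) else 0) ≤
      medianProb G.card * medianProb H.card := by
  rw [Fintype.expect_eq_sum_div_card, Fintype.card_finset]
  have hH : H ⊆ Finset.univ \ G := fun x hx =>
    Finset.mem_sdiff.2 ⟨Finset.mem_univ x, fun h => Finset.disjoint_left.1 hGH h hx⟩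
  have hcard : Fintype.card ι = G.card + H.card + ((Finset.univ \ G) \ H).card := by
    have h1 := Finset.card_sdiff_add_card_eq_card (Finset.subset_univ G)
    have h2 := Finset.card_sdiff_add_card_eq_card hH
    rw [Finset.card_univ] at h1
    omega
  have hsum : ∑ Y : Finset ι, (if (Y ∩ G).card = k ∧ (Y ∩ H).card = l then (1 : ℝ) else 0) =
      G.card.choose k * (H.card.choose l * 2 ^ ((Finset.univ \ G) \ H).card) := by
    have h1 : ∀ Y : Finset ι, (if (Y ∩ G).card = k ∧ (Y ∩ H).card = l then (1 : ℝ) else 0) =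
        (if (Y ∩ G).card = k then (1 : ℝ) else 0) *
          (if ((Y \ G) ∩ H).card = l then (1 : ℝ) else 0) := by
      intro Y
      have : (Y \ G) ∩ H = Y ∩ H := by
        ext x
        have : x ∈ G → x ∉ H := fun h => Finset.disjoint_left.1 hGH h
        simp only [Finset.mem_inter, Finset.mem_sdiff]
        tauto
      rw [this, ite_and]
      split_ifs <;> norm_num
    simp_rw [h1]
    rw [← Finset.powerset_univ, Finset.sum_powerset_inter_sdiff (Finset.subset_univ G)
      (fun A B => (if A.card = k then (1 : ℝ) else 0) *
        (if (B ∩ H).card = l then (1 : ℝ) else 0)), ← Finset.sum_mul_sum, sum_powerset_card_eq,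
      Finset.sum_powerset_inter_sdiff hH (fun A _ => if A.card = l then (1 : ℝ) else 0)]
    simp_rw [Finset.sum_const, Finset.card_powerset, nsmul_eq_mul, ← Finset.mul_sum]
    rw [sum_powerset_card_eq]
    push_cast
    ring
  rw [hsum, hcard]
  push_cast
  rw [div_le_iff₀ (by positivity), pow_add, pow_add]
  have h1 := choose_le_two_pow_mul_medianProb G.card k
  have h2 := choose_le_two_pow_mul_medianProb H.card l
  have h3 := medianProb_nonneg G.card
  calc (G.card.choose k : ℝ) * (H.card.choose l * 2 ^ ((Finset.univ \ G) \ H).card)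
      ≤ (2 ^ G.card * medianProb G.card) *
        ((2 ^ H.card * medianProb H.card) * 2 ^ ((Finset.univ \ G) \ H).card) := by gcongr
    _ = _ := by ring

theorem pluralityScore_eq_add (Q : Profile m n) (H : Finset (Fin n)) (y : Fin m) :
    pluralityScore Q y = (H.filter fun j => topRank (Q j) = y).card +
      (Hᶜ.filter fun j => topRank (Q j) = y).card := by
  rw [pluralityScore, ← Finset.card_union_of_disjoint
    (Finset.disjoint_filter_filter disjoint_compl_right), ← Finset.filter_union,
    Finset.union_compl]

-- Exchanging `a, b` inside `H` and `b, c` outside it provides two independent binomial variables,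
-- which the two near-equalities of scores confine to at most 25 pairs of values.
open scoped Classical in
theorem expect_isNearTriple_orient_le {a b c : Fin m} (hab : a ≠ b) (hbc : b ≠ c) (hac : a ≠ c)
    (H : Finset (Fin n)) (P : Profile m n) :
    𝔼 Y, (if IsNearTriple (orient (fun j => if j ∈ H then a else b)
      (fun j => if j ∈ H then b else c) P Y) a b c then (1 : ℝ) else 0) ≤
    25 * (medianProb (H.filter fun j => topRank (P j) = a ∨ topRank (P j) = b).card *
      medianProb (Hᶜ.filter fun j => topRank (P j) = b ∨ topRank (P j) = c).card) := by
  set p : Fin n → Fin m := fun j => if j ∈ H then a else b with hp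
  set q : Fin n → Fin m := fun j => if j ∈ H then b else c with hq
  set G₁ := H.filter fun j => topRank (P j) = a ∨ topRank (P j) = b with hG₁
  set G₂ := Hᶜ.filter fun j => topRank (P j) = b ∨ topRank (P j) = c with hG₂
  have hdisj : Disjoint G₁ G₂ := Finset.disjoint_filter_filter disjoint_compl_right
  have hpq : ∀ j, p j ≠ q j := by
    intro j; simp only [hp, hq]; split_ifs <;> assumption
  have hp1 : ∀ {j}, j ∈ H → p j = a := fun h => if_pos h
  have hq1 : ∀ {j}, j ∈ H → q j = b := fun h => if_pos h
  have hp2 : ∀ {j}, j ∉ H → p j = b := fun h => if_neg h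
  have hq2 : ∀ {j}, j ∉ H → q j = c := fun h => if_neg h
  have hsa : ∀ Y, pluralityScore (orient p q P Y) a =
      (Y ∩ G₁).card + (Hᶜ.filter fun j => topRank (P j) = a).card := by
    intro Y
    rw [pluralityScore_eq_add _ H]
    congr 2
    · ext j
      simp only [hG₁, Finset.mem_filter, Finset.mem_inter]
      by_cases h : j ∈ H
      · have := topRank_orient_eq_left_iff P Y (hpq j)
        rw [hp1 h, hq1 h] at this
        tauto
      · tauto
    · ext j
      simp only [Finset.mem_filter, Finset.mem_compl]
      by_cases h : j ∈ H
      · tauto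
      · have := topRank_orient_eq_of_ne_iff (p := p) (q := q) (j := j) (c := a) P Y (by rw [hp2 h]; exact hab)
          (by rw [hq2 h]; exact hac)
        tauto
  have hsb : ∀ Y, pluralityScore (orient p q P Y) b = (G₁ \ Y).card + (Y ∩ G₂).card := by
    intro Y
    rw [pluralityScore_eq_add _ H]
    congr 2
    · ext j
      simp only [hG₁, Finset.mem_filter, Finset.mem_sdiff]
      by_cases h : j ∈ H
      · have := topRank_orient_eq_right_iff P Y (hpq j)
        rw [hp1 h, hq1 h] at this
        tauto
      · tauto
    · ext j
      simp only [hG₂, Finset.mem_filter, Finset.mem_inter, Finset.mem_compl]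
      by_cases h : j ∈ H
      · tauto
      · have := topRank_orient_eq_left_iff P Y (hpq j)
        rw [hp2 h, hq2 h] at this
        tauto
  have hsc : ∀ Y, pluralityScore (orient p q P Y) c =
      (H.filter fun j => topRank (P j) = c).card + (G₂ \ Y).card := by
    intro Y
    rw [pluralityScore_eq_add _ H]
    congr 2
    · ext j
      simp only [Finset.mem_filter]
      by_cases h : j ∈ H
      · have := topRank_orient_eq_of_ne_iff (p := p) (q := q) (j := j) (c := c) P Y (by rw [hp1 h]; exact hac.symm)
          (by rw [hq1 h]; exact hbc.symm)
        tauto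
      · tauto
    · ext j
      simp only [hG₂, Finset.mem_filter, Finset.mem_sdiff, Finset.mem_compl]
      by_cases h : j ∈ H
      · tauto
      · have := topRank_orient_eq_right_iff P Y (hpq j)
        rw [hp2 h, hq2 h] at this
        tauto
  set α := (Hᶜ.filter fun j => topRank (P j) = a).card
  set γ := (H.filter fun j => topRank (P j) = c).card
  -- Here `i` and `k` are the score differences `a - b` and `c - b`. Both are linear in `|Y ∩ G₁|`
  -- and `|Y ∩ G₂|`, and `x`, `z` invert this system, whose determinant has absolute value 3.
  set x : ℤ → ℤ → ℤ := fun i k => (2 * (i - (α - G₁.card)) - (k - (γ + G₂.card - G₁.card))) / 3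
    with hx
  set z : ℤ → ℤ → ℤ := fun i k => 2 * x i k + (α - G₁.card) - i with hz
  have hpt : ∀ Y : Finset (Fin n),
      (if IsNearTriple (orient p q P Y) a b c then (1 : ℝ) else 0) ≤
      ∑ i ∈ Finset.Icc (-2 : ℤ) 2, ∑ k ∈ Finset.Icc (-2 : ℤ) 2,
        if (Y ∩ G₁).card = (x i k).toNat ∧ (Y ∩ G₂).card = (z i k).toNat then (1 : ℝ) else 0 := by
    intro Y
    have hnn : ∀ i k : ℤ, 0 ≤ if (Y ∩ G₁).card = (x i k).toNat ∧ (Y ∩ G₂).card = (z i k).toNat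
        then (1 : ℝ) else 0 := fun i k => by split_ifs <;> norm_num
    by_cases h : IsNearTriple (orient p q P Y) a b c
    swap
    · rw [if_neg h]
      exact Finset.sum_nonneg fun _ _ => Finset.sum_nonneg fun _ _ => hnn _ _
    rw [if_pos h]
    have h1 := h.ab
    have h2 := h.ba
    have h3 := h.bc
    have h4 := h.cb
    rw [hsa, hsb] at h1 h2
    rw [hsb, hsc] at h3 h4
    have hc1 := Finset.card_inter_add_card_sdiff G₁ Y
    have hc2 := Finset.card_inter_add_card_sdiff G₂ Y
    rw [Finset.inter_comm] at hc1 hc2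
    set i : ℤ := ((Y ∩ G₁).card + α : ℤ) - ((G₁ \ Y).card + (Y ∩ G₂).card) with hi
    set k : ℤ := (γ + (G₂ \ Y).card : ℤ) - ((G₁ \ Y).card + (Y ∩ G₂).card) with hk
    have e1 : x i k = (Y ∩ G₁).card := by simp only [hx]; omega
    have e2 : z i k = (Y ∩ G₂).card := by simp only [hz, e1]; omega
    have hone : (1 : ℝ) = if (Y ∩ G₁).card = (x i k).toNat ∧ (Y ∩ G₂).card = (z i k).toNat
        then (1 : ℝ) else 0 := by
      rw [e1, e2, Int.toNat_natCast, Int.toNat_natCast, if_pos ⟨rfl, rfl⟩]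
    have hi2 : i ∈ Finset.Icc (-2 : ℤ) 2 := by rw [Finset.mem_Icc]; omega
    have hk2 : k ∈ Finset.Icc (-2 : ℤ) 2 := by rw [Finset.mem_Icc]; omega
    calc (1 : ℝ) = _ := hone
      _ ≤ ∑ k ∈ Finset.Icc (-2 : ℤ) 2,
          if (Y ∩ G₁).card = (x i k).toNat ∧ (Y ∩ G₂).card = (z i k).toNat then (1 : ℝ) else 0 :=
        Finset.single_le_sum (f := fun k => if (Y ∩ G₁).card = (x i k).toNat ∧
          (Y ∩ G₂).card = (z i k).toNat then (1 : ℝ) else 0) (fun _ _ => hnn _ _) hk2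
      _ ≤ _ := Finset.single_le_sum (f := fun i => ∑ k ∈ Finset.Icc (-2 : ℤ) 2,
          if (Y ∩ G₁).card = (x i k).toNat ∧ (Y ∩ G₂).card = (z i k).toNat then (1 : ℝ) else 0)
          (fun _ _ => Finset.sum_nonneg fun _ _ => hnn _ _) hi2
  calc _ ≤ 𝔼 Y : Finset (Fin n), ∑ i ∈ Finset.Icc (-2 : ℤ) 2, ∑ k ∈ Finset.Icc (-2 : ℤ) 2,
        (if (Y ∩ G₁).card = (x i k).toNat ∧ (Y ∩ G₂).card = (z i k).toNat then (1 : ℝ) else 0) :=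
        Finset.expect_le_expect fun Y _ => hpt Y
    _ = ∑ i ∈ Finset.Icc (-2 : ℤ) 2, ∑ k ∈ Finset.Icc (-2 : ℤ) 2, 𝔼 Y : Finset (Fin n),
        (if (Y ∩ G₁).card = (x i k).toNat ∧ (Y ∩ G₂).card = (z i k).toNat
          then (1 : ℝ) else 0) := by
        rw [Finset.expect_sum_comm]
        exact Finset.sum_congr rfl fun i _ => Finset.expect_sum_comm _ _ _
    _ ≤ ∑ i ∈ Finset.Icc (-2 : ℤ) 2, ∑ k ∈ Finset.Icc (-2 : ℤ) 2,
        medianProb G₁.card * medianProb G₂.card :=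
        Finset.sum_le_sum fun i _ => Finset.sum_le_sum fun k _ => expect_card_inter_eq_le hdisj _ _
    _ = _ := by
        have h5 : (Finset.Icc (-2 : ℤ) 2).card = 5 := rfl
        simp only [Finset.sum_const, h5, nsmul_eq_mul]
        push_cast
        ring

open scoped Classical in
/-- Near triples have probability `O(1 / n)`. -/
theorem expect_isNearTriple_le (hn : 2 ≤ n) (a b c : Fin m) :
    𝔼 P : Profile m n, (if IsNearTriple P a b c then (1 : ℝ) else 0) ≤
      1050 * (Fintype.card (Ranking m) : ℝ) ^ 2 / n := by
  by_cases hne : a ≠ b ∧ b ≠ c ∧ a ≠ c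
  swap
  · have : ∀ P : Profile m n, ¬ IsNearTriple P a b c := fun P h => hne ⟨h.ne_ab, h.ne_bc, h.ne_ac⟩
    simp only [this, if_false, Finset.expect_const_zero]
    positivity
  obtain ⟨hab, hbc, hac⟩ := hne
  -- For `n ≥ 2` both `H` and its complement contain at least a third of the agents.
  obtain ⟨H, -, hH⟩ := Finset.exists_subset_card_eq (s := (Finset.univ : Finset (Fin n)))
    (n := n / 2) (by rw [Finset.card_univ, Fintype.card_fin]; omega)
  have hHc := Finset.card_compl H
  rw [Fintype.card_fin] at hHc
  have htop : ∀ a b : Fin m, (Finset.univ.filter fun R : Ranking m =>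
      topRank R = a ∨ topRank R = b).Nonempty := fun a b =>
    ⟨Equiv.swap 0 a, by simp [topRank_swap]⟩
  have h1 := expect_inv_card_filter_le (n := n) (by omega) (J := H) (by omega) (htop a b)
  have h2 := expect_inv_card_filter_le (n := n) (by omega) (J := Hᶜ) (by omega) (htop b c)
  simp only [Finset.mem_filter, Finset.mem_univ, true_and] at h1 h2
  have hsq : ∀ k l : ℕ, medianProb k * medianProb l ≤
      (1 / ((k : ℝ) + 1) + 1 / ((l : ℝ) + 1)) / 2 := by
    intro k l
    have hk : medianProb k ^ 2 ≤ 1 / ((k : ℝ) + 1) := by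
      rw [le_div_iff₀ (by positivity)]; exact medianProb_sq_le k
    have hl : medianProb l ^ 2 ≤ 1 / ((l : ℝ) + 1) := by
      rw [le_div_iff₀ (by positivity)]; exact medianProb_sq_le l
    nlinarith [sq_nonneg (medianProb k - medianProb l)]
  rw [expect_orient (fun j => if j ∈ H then a else b) (fun j => if j ∈ H then b else c)]
  calc _ ≤ 𝔼 P : Profile m n, 25 *
        ((1 / (((H.filter fun j => topRank (P j) = a ∨ topRank (P j) = b).card : ℝ) + 1) +
        1 / (((Hᶜ.filter fun j => topRank (P j) = b ∨ topRank (P j) = c).card : ℝ) + 1)) / 2) :=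
        Finset.expect_le_expect fun P _ =>
          (expect_isNearTriple_orient_le hab hbc hac H P).trans
            (mul_le_mul_of_nonneg_left (hsq _ _) (by norm_num))
    _ = 25 * ((𝔼 P : Profile m n,
        1 / (((H.filter fun j => topRank (P j) = a ∨ topRank (P j) = b).card : ℝ) + 1) +
        𝔼 P : Profile m n,
        1 / (((Hᶜ.filter fun j => topRank (P j) = b ∨ topRank (P j) = c).card : ℝ) + 1)) / 2) := by
        rw [← Finset.mul_expect, ← Finset.expect_div, Finset.expect_add_distrib]
    _ ≤ 25 * ((42 * (Fintype.card (Ranking m) : ℝ) ^ 2 / n +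
        42 * (Fintype.card (Ranking m) : ℝ) ^ 2 / n) / 2) := by gcongr
    _ = _ := by ring

end NearTriples

/-! ### Assembling the expected loss -/

section ExpectedLoss

variable {m n : ℕ} [NeZero m]

theorem expectedADPoA_impartialCulture (u : Fin m → ℝ) :
    expectedADPoA u (impartialCulture m n) = 𝔼 P : Profile m n, adversarialLoss u P := by
  rw [expectedADPoA, Fintype.expect_eq_sum_div_card, Finset.sum_div]
  refine Finset.sum_congr rfl fun P _ => ?_
  rw [impartialCulture, PMF.uniformOfFintype_apply, ENNReal.toReal_inv, ENNReal.toReal_natCast,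
    div_eq_inv_mul]

theorem IsUtilityVector.abs_sub_le {u : Fin m → ℝ} (hu : IsUtilityVector u) (x y : Fin m) :
    |u x - u y| ≤ u 0 := by
  have h1 := hu.antitone (Fin.zero_le x)
  have h2 := hu.antitone (Fin.zero_le y)
  have h3 := hu.nonneg x
  have h4 := hu.nonneg y
  rw [abs_le]
  constructor <;> linarith

theorem expect_utility_sub {m : ℕ} (u : Fin m → ℝ) (a b : Fin m) :
    𝔼 R : Ranking m, (u (R a) - u (R b)) = 0 := by
  rw [Finset.expect_sub_distrib, sub_eq_zero]
  refine Fintype.expect_equiv (Equiv.mulRight (Equiv.swap a b)) _ _ fun R => ?_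
  simp

theorem expect_socialWelfare_sub_pow_four_le {u : Fin m → ℝ} (hu : IsUtilityVector u)
    (a b : Fin m) :
    𝔼 P : Profile m n, (socialWelfare u P a - socialWelfare u P b) ^ 4 ≤
      3 * (n : ℝ) ^ 2 * u 0 ^ 4 := by
  have h := expect_sum_pow_four_le (n := n) (f := fun _ (R : Ranking m) => u (R a) - u (R b))
    (fun _ => expect_utility_sub u a b) fun _ R => hu.abs_sub_le (R a) (R b)
  simpa only [socialWelfare, Finset.sum_sub_distrib] using h

open scoped Classical in
theorem expect_nearTriple_mul_abs_le {u : Fin m → ℝ} (hu : IsUtilityVector u) (hn : 2 ≤ n)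
    {r : ℝ} (hr : 0 < r) (hrn : r ^ 4 = n) (a b c d e : Fin m) :
    𝔼 P : Profile m n, (if IsNearTriple P a b c then (1 : ℝ) else 0) *
      |socialWelfare u P d - socialWelfare u P e| ≤
      (1050 * (Fintype.card (Ranking m) : ℝ) ^ 2 + 3 * u 0 ^ 4) / r := by
  -- Truncation at `r ^ 3 = n^(3/4)`, above the typical size `n^(1/2)` of a welfare gap. With
  -- probability `O(1/n)` and fourth moment `O(n^2)`, both terms average to `O(1/r)`.
  have hpt : ∀ t x : ℝ, 0 ≤ t → t ≤ 1 → t * |x| ≤ r ^ 3 * t + x ^ 4 / r ^ 9 := by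
    intro t x ht0 ht1
    have hx4 : 0 ≤ x ^ 4 / r ^ 9 := by positivity
    by_cases h : |x| ≤ r ^ 3
    · nlinarith [mul_le_mul_of_nonneg_left h ht0]
    · push Not at h
      have h1 : |x| ≤ x ^ 4 / r ^ 9 := by
        rw [le_div_iff₀ (by positivity)]
        have h2 : (r ^ 3) ^ 3 ≤ |x| ^ 3 := pow_le_pow_left₀ (by positivity) h.le 3
        calc |x| * r ^ 9 = |x| * (r ^ 3) ^ 3 := by ring
          _ ≤ |x| * |x| ^ 3 := mul_le_mul_of_nonneg_left h2 (abs_nonneg x)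
          _ = |x| ^ 4 := by ring
          _ = x ^ 4 := Even.pow_abs (by decide) x
      have h3 : t * |x| ≤ |x| := mul_le_of_le_one_left (abs_nonneg x) ht1
      have h4 : 0 ≤ r ^ 3 * t := by positivity
      linarith
  calc _ ≤ 𝔼 P : Profile m n, (r ^ 3 * (if IsNearTriple P a b c then (1 : ℝ) else 0) +
        (socialWelfare u P d - socialWelfare u P e) ^ 4 / r ^ 9) :=
        Finset.expect_le_expect fun P _ => hpt _ _ (by split_ifs <;> norm_num)
          (by split_ifs <;> norm_num)
    _ = r ^ 3 * 𝔼 P : Profile m n, (if IsNearTriple P a b c then (1 : ℝ) else 0) +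
        (𝔼 P : Profile m n, (socialWelfare u P d - socialWelfare u P e) ^ 4) / r ^ 9 := by
        rw [Finset.expect_add_distrib, Finset.mul_expect, Finset.expect_div]
    _ ≤ r ^ 3 * (1050 * (Fintype.card (Ranking m) : ℝ) ^ 2 / n) +
        (3 * (n : ℝ) ^ 2 * u 0 ^ 4) / r ^ 9 := by
        gcongr
        · exact expect_isNearTriple_le hn a b c
        · exact expect_socialWelfare_sub_pow_four_le hu d e
    _ = _ := by
        rw [← hrn]
        field_simp

theorem expect_medianProb_backers_le (hn : 0 < n) {r : ℝ} (hr : 1 ≤ r) (hrn : r ^ 4 = n)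
    (a b : Fin m) :
    𝔼 P : Profile m n, medianProb (backers P a b).card ≤
      (1 + 42 * (Fintype.card (Ranking m) : ℝ) ^ 2) / r := by
  have hr0 : 0 < r := by linarith
  have hcount := expect_inv_card_filter_le hn (J := Finset.univ)
    (by rw [Finset.card_univ, Fintype.card_fin]; omega)
    (A := Finset.univ.filter fun R : Ranking m => topRank R = a ∨ topRank R = b)
    ⟨Equiv.swap 0 a, by simp [topRank_swap]⟩
  simp only [Finset.mem_filter, Finset.mem_univ, true_and] at hcount
  have hpt : ∀ k : ℕ, medianProb k ≤ 1 / r + r * (1 / ((k : ℝ) + 1)) := by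
    intro k
    have hk : medianProb k ^ 2 ≤ 1 / ((k : ℝ) + 1) := by
      rw [le_div_iff₀ (by positivity)]; exact medianProb_sq_le k
    have h1 : 1 / r + r * medianProb k ^ 2 - medianProb k =
        ((r * medianProb k - 1 / 2) ^ 2 + 3 / 4) / r := by field_simp; ring
    have h2 : 0 ≤ 1 / r + r * medianProb k ^ 2 - medianProb k := by rw [h1]; positivity
    nlinarith [mul_le_mul_of_nonneg_left hk hr0.le]
  calc _ ≤ 𝔼 P : Profile m n, (1 / r + r * (1 / (((backers P a b).card : ℝ) + 1))) :=
        Finset.expect_le_expect fun P _ => hpt _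
    _ = 1 / r + r * 𝔼 P : Profile m n, 1 / (((backers P a b).card : ℝ) + 1) := by
        rw [Finset.expect_add_distrib, Finset.mul_expect, Fintype.expect_const]
    _ ≤ 1 / r + r * (42 * (Fintype.card (Ranking m) : ℝ) ^ 2 / n) := by
        gcongr
        exact hcount
    _ = (1 + 42 * (Fintype.card (Ranking m) : ℝ) ^ 2 / r ^ 2) / r := by
        rw [← hrn]; field_simp
    _ ≤ _ := by
        gcongr
        exact div_le_self (by positivity) (one_le_pow₀ hr)

/-- The utility gap between `a` and `b` in a ranking that puts neither of them on top. -/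
noncomputable def thirdPartyGap (u : Fin m → ℝ) (a b : Fin m) (R : Ranking m) : ℝ :=
  if topRank R = a ∨ topRank R = b then 0 else |u (R a) - u (R b)|

theorem le_expect_thirdPartyGap (hm : 3 ≤ m) (u : Fin m → ℝ) {a b i l : Fin m} (hab : a ≠ b)
    (hi : i.val = 1) (hl : l.val = m - 1) :
    (u i - u l) / Fintype.card (Ranking m) ≤
      𝔼 R, thirdPartyGap u a b R := by
  rw [Fintype.expect_eq_sum_div_card]
  refine div_le_div_of_nonneg_right ?_ (Nat.cast_nonneg _)
  -- One ranking suffices: `a` second and `b` last. As `m ≥ 3` these positions differ, and a third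
  -- alternative is on top.
  obtain ⟨R, hR1, hR2⟩ : ∃ R : Ranking m, R a = i ∧ R b = l := by
    have h1 : (Equiv.swap a i : Ranking m) b ≠ i := fun e => by
      rw [Equiv.swap_apply_eq_iff, Equiv.swap_apply_right] at e
      exact hab e.symm
    refine ⟨(Equiv.swap a i).trans
      (Equiv.swap ((Equiv.swap a i : Ranking m) b) l), ?_, ?_⟩
    · rw [Equiv.trans_apply, Equiv.swap_apply_left, Equiv.swap_apply_of_ne_of_ne h1.symm]
      intro e
      have := congrArg Fin.val e
      omega
    · rw [Equiv.trans_apply, Equiv.swap_apply_left]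
  have hnn : ∀ R, 0 ≤ thirdPartyGap u a b R := fun R => by
    unfold thirdPartyGap; split_ifs
    · exact le_rfl
    · exact abs_nonneg _
  refine le_trans ?_ (Finset.single_le_sum (fun R _ => hnn R) (Finset.mem_univ R))
  have htop : ¬ (topRank R = a ∨ topRank R = b) := by
    have h0 := apply_topRank R
    rintro (e | e)
    · rw [e, hR1] at h0
      have := congrArg Fin.val h0
      rw [hi, Fin.val_zero] at this
      omega
    · rw [e, hR2] at h0
      have := congrArg Fin.val h0
      rw [hl, Fin.val_zero] at this
      omega
  rw [thirdPartyGap, if_neg htop, hR1, hR2]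
  exact le_abs_self _

-- The non-backers' total utility gap concentrates at `n * ω`, with `ω` the mean of `thirdPartyGap`.
-- Replacing it by this mean lets the indicator of `LeadsJointly` be averaged separately, although
-- the two are dependent.
open scoped Classical in
theorem expect_duelLoss_le (hm : 3 ≤ m) {u : Fin m → ℝ} (hu : IsUtilityVector u) (hn : 0 < n)
    {i l : Fin m} (hi : i.val = 1) (hl : l.val = m - 1) (hδ : u l ≤ u i)
    {r : ℝ} (hr : 1 ≤ r) (hrn : r ^ 4 = n) (a b : Fin m) :
    𝔼 P : Profile m n, (if IsDuel P a b then duelLoss u P a b else 0) ≤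
      -((u i - u l) / Fintype.card (Ranking m) / 8 *
        𝔼 P : Profile m n, if LeadsJointly P a b then (1 : ℝ) else 0) +
      (1 + u 0 ^ 2 + u 0 * (1 + 42 * (Fintype.card (Ranking m) : ℝ) ^ 2)) / r := by
  have hr0 : 0 < r := by linarith
  have hu0 : 0 ≤ u 0 := hu.nonneg 0
  by_cases hab : a = b
  · have h1 : ∀ P : Profile m n, ¬ IsDuel P a b := fun P h => h.lt.ne hab
    have h2 : ∀ P : Profile m n, ¬ LeadsJointly P a b := fun P h => h.lt.ne hab
    simp only [h1, h2, if_false, Finset.expect_const_zero, mul_zero, neg_zero, zero_add]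
    positivity
  set δ := (u i - u l) / Fintype.card (Ranking m) with hδdef
  have hδ0 : 0 ≤ δ := div_nonneg (sub_nonneg.2 hδ) (Nat.cast_nonneg _)
  set ω := 𝔼 R, thirdPartyGap u a b R with hω
  have hδω : δ ≤ ω := le_expect_thirdPartyGap hm u hab hi hl
  have hgap0 : ∀ R, 0 ≤ thirdPartyGap u a b R := fun R => by
    unfold thirdPartyGap; split_ifs
    · exact le_rfl
    · exact abs_nonneg _
  have hgapU : ∀ R, thirdPartyGap u a b R ≤ u 0 := fun R => by
    unfold thirdPartyGap; split_ifs
    · exact hu0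
    · exact hu.abs_sub_le _ _
  have hω0 : 0 ≤ ω := hδ0.trans hδω
  have hωU : ω ≤ u 0 := Finset.expect_le Finset.univ_nonempty fun R _ => hgapU R
  have hdev := expect_abs_sum_le (n := n) (r := r ^ 3) (U := u 0)
    (f := fun _ R => thirdPartyGap u a b R - ω)
    (fun _ => by rw [Finset.expect_sub_distrib, Fintype.expect_const, sub_self])
    (fun _ R => abs_le.2 ⟨by linarith [hgap0 R], by linarith [hgapU R]⟩) (by positivity)
  have hW : ∀ P : Profile m n, ∑ j ∈ Finset.univ \ backers P a b, |u (P j a) - u (P j b)| =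
      n * ω + ∑ j, (thirdPartyGap u a b (P j) - ω) := by
    intro P
    rw [Finset.sum_sub_distrib, Finset.sum_const, Finset.card_univ, Fintype.card_fin, nsmul_eq_mul,
      add_sub_cancel, backers, ← Finset.filter_not, Finset.sum_filter]
    refine Finset.sum_congr rfl fun j _ => ?_
    rw [thirdPartyGap]
    split_ifs <;> rfl
  have hn1 : (1 : ℝ) ≤ n := by exact_mod_cast hn
  have hpt : ∀ P : Profile m n, (if LeadsJointly P a b then -(1 / (4 * ((n : ℝ) + 1)) *
      ∑ j ∈ Finset.univ \ backers P a b, |u (P j a) - u (P j b)|) else 0) ≤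
      -(δ / 8 * if LeadsJointly P a b then (1 : ℝ) else 0) +
        1 / (4 * ((n : ℝ) + 1)) * |∑ j, (thirdPartyGap u a b (P j) - ω)| := by
    intro P
    have habs := neg_abs_le (∑ j, (thirdPartyGap u a b (P j) - ω))
    have hk : (0 : ℝ) ≤ 1 / (4 * ((n : ℝ) + 1)) := by positivity
    split_ifs
    · rw [hW, mul_one]
      -- The 8 combines the factor 4 with `n / (n + 1) ≥ 1 / 2`.
      have h1 : δ / 8 ≤ 1 / (4 * ((n : ℝ) + 1)) * (n * ω) := by
        rw [div_mul_eq_mul_div, one_mul, div_le_div_iff₀ (by norm_num) (by positivity)]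
        nlinarith
      nlinarith [mul_le_mul_of_nonneg_left habs hk]
    · rw [mul_zero, neg_zero, zero_add]
      positivity
  rw [expect_orient (fun _ => a) (fun _ => b)]
  calc _ ≤ 𝔼 P : Profile m n, ((-(δ / 8 * if LeadsJointly P a b then (1 : ℝ) else 0) +
        1 / (4 * ((n : ℝ) + 1)) * |∑ j, (thirdPartyGap u a b (P j) - ω)|) +
        u 0 * medianProb (backers P a b).card) :=
        Finset.expect_le_expect fun P _ => (expect_duelLoss_orient_le hu hab P).trans
          (add_le_add (hpt P) le_rfl)
    _ = -(δ / 8 * 𝔼 P : Profile m n, if LeadsJointly P a b then (1 : ℝ) else 0) +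
        1 / (4 * ((n : ℝ) + 1)) *
          (𝔼 P : Profile m n, |∑ j, (thirdPartyGap u a b (P j) - ω)|) +
        u 0 * 𝔼 P : Profile m n, medianProb (backers P a b).card := by
        rw [Finset.expect_add_distrib, Finset.expect_add_distrib, Finset.expect_neg_distrib,
          Finset.mul_expect, Finset.mul_expect, Finset.mul_expect]
    _ ≤ -(δ / 8 * 𝔼 P : Profile m n, if LeadsJointly P a b then (1 : ℝ) else 0) +
        1 / (4 * ((n : ℝ) + 1)) * (r ^ 3 + n * u 0 ^ 2 / r ^ 3) +
        u 0 * ((1 + 42 * (Fintype.card (Ranking m) : ℝ) ^ 2) / r) := by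
        gcongr
        exact expect_medianProb_backers_le hn hr hrn a b
    _ ≤ -(δ / 8 * 𝔼 P : Profile m n, if LeadsJointly P a b then (1 : ℝ) else 0) +
        (1 + u 0 ^ 2) / r + u 0 * ((1 + 42 * (Fintype.card (Ranking m) : ℝ) ^ 2) / r) := by
        gcongr
        have h1 : 1 / (4 * ((n : ℝ) + 1)) ≤ 1 / n := by
          apply one_div_le_one_div_of_le <;> linarith
        have h2 : r ^ 3 + n * u 0 ^ 2 / r ^ 3 ≤ (1 + u 0 ^ 2) * r ^ 3 := by
          rw [← hrn]
          have : r ^ 4 * u 0 ^ 2 / r ^ 3 = u 0 ^ 2 * r := by field_simp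
          rw [this]
          have h3 : r ≤ r ^ 3 := le_self_pow₀ hr (by norm_num)
          nlinarith [mul_le_mul_of_nonneg_left h3 (sq_nonneg (u 0))]
        calc 1 / (4 * ((n : ℝ) + 1)) * (r ^ 3 + n * u 0 ^ 2 / r ^ 3)
            ≤ 1 / n * ((1 + u 0 ^ 2) * r ^ 3) := by gcongr
          _ = (1 + u 0 ^ 2) / r := by rw [← hrn]; field_simp
    _ = _ := by ring

-- Every profile has a jointly leading pair or a near triple, so the leading pairs carry total mass
-- `1 - O(1/n)`. No limiting distribution of the scores is needed.
open scoped Classical in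
theorem one_le_sum_leadsJointly_add (hm : 2 ≤ m) (hn : 2 ≤ n) :
    1 ≤ (∑ a, ∑ b, 𝔼 P : Profile m n, if LeadsJointly P a b then (1 : ℝ) else 0) +
      (m : ℝ) ^ 3 * (1050 * (Fintype.card (Ranking m) : ℝ) ^ 2 / n) := by
  have h01 : ∀ p : Prop, 0 ≤ if p then (1 : ℝ) else 0 := fun p => by split_ifs <;> norm_num
  have hpt : ∀ P : Profile m n, 1 ≤ (∑ a, ∑ b, if LeadsJointly P a b then (1 : ℝ) else 0) +
      ∑ a, ∑ b, ∑ c, if IsNearTriple P a b c then (1 : ℝ) else 0 := by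
    intro P
    have hA : 0 ≤ ∑ a, ∑ b, if LeadsJointly P a b then (1 : ℝ) else 0 :=
      Finset.sum_nonneg fun _ _ => Finset.sum_nonneg fun _ _ => h01 _
    have hB : 0 ≤ ∑ a, ∑ b, ∑ c, if IsNearTriple P a b c then (1 : ℝ) else 0 :=
      Finset.sum_nonneg fun _ _ => Finset.sum_nonneg fun _ _ => Finset.sum_nonneg fun _ _ => h01 _
    by_cases h : ∀ a b c, ¬ IsNearTriple P a b c
    · obtain ⟨a, b, hL⟩ := exists_leadsJointly hm h
      refine le_add_of_le_of_nonneg ?_ hB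
      by_contra! hlt
      have h1 := Finset.single_le_sum (f := fun b => if LeadsJointly P a b then (1 : ℝ) else 0)
        (fun _ _ => h01 _) (Finset.mem_univ b)
      have h2 := Finset.single_le_sum
        (f := fun a => ∑ b, if LeadsJointly P a b then (1 : ℝ) else 0)
        (fun _ _ => Finset.sum_nonneg fun _ _ => h01 _) (Finset.mem_univ a)
      simp only [hL, if_true] at h1
      linarith
    · push Not at h
      obtain ⟨a, b, c, hT⟩ := h
      refine le_add_of_nonneg_of_le hA ?_
      by_contra! hlt
      have h1 := Finset.single_le_sum (f := fun c => if IsNearTriple P a b c then (1 : ℝ) else 0)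
        (fun _ _ => h01 _) (Finset.mem_univ c)
      have h2 := Finset.single_le_sum
        (f := fun b => ∑ c, if IsNearTriple P a b c then (1 : ℝ) else 0)
        (fun _ _ => Finset.sum_nonneg fun _ _ => h01 _) (Finset.mem_univ b)
      have h3 := Finset.single_le_sum
        (f := fun a => ∑ b, ∑ c, if IsNearTriple P a b c then (1 : ℝ) else 0)
        (fun _ _ => Finset.sum_nonneg fun _ _ => Finset.sum_nonneg fun _ _ => h01 _)
        (Finset.mem_univ a)
      simp only [hT, if_true] at h1
      linarith
  calc (1 : ℝ) = 𝔼 _P : Profile m n, (1 : ℝ) := (Fintype.expect_const _).symm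
    _ ≤ 𝔼 P : Profile m n, ((∑ a, ∑ b, if LeadsJointly P a b then (1 : ℝ) else 0) +
        ∑ a, ∑ b, ∑ c, if IsNearTriple P a b c then (1 : ℝ) else 0) :=
        Finset.expect_le_expect fun P _ => hpt P
    _ = (∑ a, ∑ b, 𝔼 P : Profile m n, if LeadsJointly P a b then (1 : ℝ) else 0) +
        ∑ a, ∑ b, ∑ c, 𝔼 P : Profile m n, if IsNearTriple P a b c then (1 : ℝ) else 0 := by
        simp only [Finset.expect_add_distrib, Finset.expect_sum_comm]
    _ ≤ (∑ a, ∑ b, 𝔼 P : Profile m n, if LeadsJointly P a b then (1 : ℝ) else 0) +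
        ∑ _a : Fin m, ∑ _b : Fin m, ∑ _c : Fin m,
          1050 * (Fintype.card (Ranking m) : ℝ) ^ 2 / n := by
        refine add_le_add le_rfl ?_
        exact Finset.sum_le_sum fun a _ => Finset.sum_le_sum fun b _ => Finset.sum_le_sum fun c _ =>
          expect_isNearTriple_le hn a b c
    _ = _ := by
        simp only [Finset.sum_const, Finset.card_univ, Fintype.card_fin, nsmul_eq_mul]
        ring

theorem expect_adversarialLoss_le (hm : 3 ≤ m) {u : Fin m → ℝ} (hu : IsUtilityVector u)
    {i l : Fin m} (hi : i.val = 1) (hl : l.val = m - 1) (hu2 : u l < u i) :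
    ∃ c K : ℝ, 0 < c ∧ ∀ (n : ℕ) (r : ℝ), 2 ≤ n → 1 ≤ r → r ^ 4 = n →
      𝔼 P : Profile m n, adversarialLoss u P ≤ -c + K / r := by
  classical
  set C := (Fintype.card (Ranking m) : ℝ) with hC
  have hC0 : 0 < C := by
    rw [hC]; exact_mod_cast (Fintype.card_pos : 0 < Fintype.card (Ranking m))
  set c := (u i - u l) / C / 8 with hc
  have hc0 : 0 < c := by
    have := sub_pos.2 hu2
    positivity
  refine ⟨c, c * (m : ℝ) ^ 3 * (1050 * C ^ 2) +
    (m : ℝ) ^ 2 * (1 + u 0 ^ 2 + u 0 * (1 + 42 * C ^ 2)) +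
    (m : ℝ) ^ 5 * (1050 * C ^ 2 + 3 * u 0 ^ 4), hc0, fun n r hn hr hrn => ?_⟩
  have hr0 : 0 < r := by linarith
  have h1 := one_le_sum_leadsJointly_add (m := m) (n := n) (by omega) hn
  have hnr : (1050 * C ^ 2) / n ≤ (1050 * C ^ 2) / r := by
    rw [← hrn]
    gcongr
    exact le_self_pow₀ hr (by norm_num)
  calc 𝔼 P : Profile m n, adversarialLoss u P
      ≤ 𝔼 P : Profile m n, ((∑ a, ∑ b, if IsDuel P a b then duelLoss u P a b else 0) +
        (∑ a, ∑ b, ∑ c, if IsNearTriple P a b c then (1 : ℝ) else 0) *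
        ∑ d, ∑ e, |socialWelfare u P d - socialWelfare u P e|) :=
        Finset.expect_le_expect fun P _ => adversarialLoss_le (by omega) u P
    _ = (∑ a, ∑ b, 𝔼 P : Profile m n, if IsDuel P a b then duelLoss u P a b else 0) +
        ∑ a, ∑ b, ∑ c, ∑ d, ∑ e, 𝔼 P : Profile m n,
          (if IsNearTriple P a b c then (1 : ℝ) else 0) *
            |socialWelfare u P d - socialWelfare u P e| := by
        simp only [Finset.sum_mul, Finset.expect_add_distrib, Finset.expect_sum_comm]
        simp only [Finset.mul_sum, Finset.expect_sum_comm]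
    _ ≤ (∑ a : Fin m, ∑ b : Fin m, (-(c * 𝔼 P : Profile m n,
          if LeadsJointly P a b then (1 : ℝ) else 0) +
          (1 + u 0 ^ 2 + u 0 * (1 + 42 * C ^ 2)) / r)) +
        ∑ _a : Fin m, ∑ _b : Fin m, ∑ _c : Fin m, ∑ _d : Fin m, ∑ _e : Fin m,
          (1050 * C ^ 2 + 3 * u 0 ^ 4) / r := by
        refine add_le_add ?_ ?_
        · exact Finset.sum_le_sum fun a _ => Finset.sum_le_sum fun b _ =>
            expect_duelLoss_le hm hu (by omega) hi hl hu2.le hr hrn a b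
        · exact Finset.sum_le_sum fun a _ => Finset.sum_le_sum fun b _ =>
            Finset.sum_le_sum fun c _ => Finset.sum_le_sum fun d _ => Finset.sum_le_sum fun e _ =>
            expect_nearTriple_mul_abs_le hu hn hr0 hrn a b c d e
    _ = -(c * ∑ a, ∑ b, 𝔼 P : Profile m n, if LeadsJointly P a b then (1 : ℝ) else 0) +
        (m : ℝ) ^ 2 * ((1 + u 0 ^ 2 + u 0 * (1 + 42 * C ^ 2)) / r) +
        (m : ℝ) ^ 5 * ((1050 * C ^ 2 + 3 * u 0 ^ 4) / r) := by
        simp only [Finset.sum_add_distrib, Finset.sum_neg_distrib, ← Finset.mul_sum,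
          Finset.sum_const, Finset.card_univ, Fintype.card_fin, nsmul_eq_mul]
        ring
    _ ≤ -(c * (1 - (m : ℝ) ^ 3 * ((1050 * C ^ 2) / r))) +
        (m : ℝ) ^ 2 * ((1 + u 0 ^ 2 + u 0 * (1 + 42 * C ^ 2)) / r) +
        (m : ℝ) ^ 5 * ((1050 * C ^ 2 + 3 * u 0 ^ 4) / r) := by
        gcongr
        have := mul_le_mul_of_nonneg_left hnr (by positivity : (0 : ℝ) ≤ (m : ℝ) ^ 3)
        linarith
    _ = _ := by ring

end ExpectedLoss

theorem theorem2 (m : ℕ) [NeZero m] (hm : 3 ≤ m) (u : Fin m → ℝ) (hu : IsUtilityVector u)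
    (hu2 : u ⟨m - 1, by omega⟩ < u ⟨1, by omega⟩) :
    (∀ (n : ℕ) (P : Profile m n), (equilibriumWinners P).Nonempty) ∧
      ∃ c : ℝ, 0 < c ∧ ∀ᶠ n : ℕ in Filter.atTop, expectedADPoA u (impartialCulture m n) ≤ -c := by
  refine ⟨fun n P => equilibriumWinners_nonempty (by omega) P, ?_⟩
  obtain ⟨c, K, hc, H⟩ := expect_adversarialLoss_le hm hu rfl rfl hu2
  refine ⟨c / 2, by positivity, ?_⟩
  -- The iterated square root is `r = n^(1/4)`; once `r ≥ 2K/c`, the error `K / r` uses up at most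
  -- half of `c`.
  have hlim : Filter.Tendsto (fun n : ℕ => √√(n : ℝ)) Filter.atTop Filter.atTop :=
    Real.tendsto_sqrt_atTop.comp (Real.tendsto_sqrt_atTop.comp tendsto_natCast_atTop_atTop)
  filter_upwards [Filter.eventually_ge_atTop 2, hlim.eventually_ge_atTop 1,
    hlim.eventually_ge_atTop (2 * K / c)] with n hn h1 h2
  rw [expectedADPoA_impartialCulture]
  have h4 : √√(n : ℝ) ^ 4 = n := by
    rw [show 4 = 2 * 2 from rfl, pow_mul, Real.sq_sqrt (Real.sqrt_nonneg _),
      Real.sq_sqrt (Nat.cast_nonneg n)]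
  have h5 : K / √√(n : ℝ) ≤ c / 2 := by
    rw [div_le_div_iff₀ (by linarith) (by norm_num)]
    rw [div_le_iff₀ hc] at h2
    linarith
  linarith [H n _ hn h1 h4]
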